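/- A \emph{degree sequence} of length $n\ge 1$ is a sequence $D=(d_1,\dots,d_n)$ of positive integers with $d_i\le n-1$ for all $i$ and with even sum $\Sigma=\sum_i d_i$; put $c_1=\max_i d_i$ and $c_2=\min_i d_i$. A \emph{realization} of a sequence $f=(f_1,\dots,f_n)$ of non-negative integers is a simple graph on $\{1,\dots,n\}$ in which vertex $i$ has degree $f_i$; $\mathcal G(f)$ is the set of realizations of $f$, and $D$ is \emph{graphic} if $\mathcal G(D)\neq\emptyset$. For a graphic $D$ let $$\partial^{++}(D)=\sum_{1\le i\le j\le n}\frac{|\mathcal G(D+e_i+e_j)|}{|\mathcal G(D)|},$$ where $e_i$ is the $i$-th unit vector. A \emph{region} is a set of degree sequences; it is \emph{simple} if membership is determined by $n,\Sigma,c_1,c_2$. A region is \emph{fully graphic} if all its elements are graphic, and it is \emph{P-stable} if there is a polynomial $p$ such that $\partial^{++}(D)\le p(n)$ for every graphic $D$ in the region, where $n$ is the length of $D$. \textbf{Theorem.} For $\varepsilon>0$ let $\mathbb D_\varepsilon$ be the simple region of all degree sequences with $$n\ge \frac1{2\varepsilon^2},\qquad 2\le c_2,\qquad 3\le c_1\le\sqrt{(1-\varepsilon)\Sigma}$$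 (which is empty if $\varepsilon\ge 1$). For every $\varepsilon>0$ the region $\mathbb D_\varepsilon$ is fully graphic and P-stable, and it is infinite if $\varepsilon<1$. Moreover, these regions extend the Greenhill--Sfragara region $\mathbb D_{GS}$ of all degree sequences with $2\le c_2$ and $3\le c_1\le\sqrt{\Sigma/9}$: one has $\mathbb D_{GS}=\mathbb D_{8/9}$, and for $0<\varepsilon<8/9$ the set of all $D\in\mathbb D_{GS}$ of length $n\ge\frac1{2\varepsilon^2}$ is a proper subset of $\mathbb D_\varepsilon$. -/

import Mathlib

/-- A degree sequence `(d₁, …, dₙ)`, `n ≥ 1`: positive integers, none exceeding `n - 1`, with even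
sum. -/
structure DegreeSequence where
  /-- the length `n` -/
  len : ℕ
  len_pos : 0 < len
  /-- the entries -/
  deg : Fin len → ℕ
  deg_pos : ∀ i, 0 < deg i
  deg_lt : ∀ i, deg i < len
  even_sum : Even (∑ i, deg i)

/-- The simple graphs on the vertex set `Fin n` in which vertex `i` has degree `f i`. -/
def realizations {n : ℕ} (f : Fin n → ℕ) : Set (SimpleGraph (Fin n)) :=
  {G | ∀ i, (G.neighborSet i).ncard = f i}

/-- The perturbation of `f` that adds `1` at position `i` and `1` at position `j`
(hence adds `2` at `j` when `i = j`). -/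
def perturb {n : ℕ} (f : Fin n → ℕ) (i j : Fin n) : Fin n → ℕ :=
  f + Pi.single i 1 + Pi.single j 1

namespace DegreeSequence

/-- The sum `Σ` of the degrees. -/
def total (D : DegreeSequence) : ℕ := ∑ i, D.deg i

/-- The largest degree `c₁`. -/
noncomputable def maxDeg (D : DegreeSequence) : ℕ := ⨆ i, D.deg i

/-- The smallest degree `c₂`. -/
noncomputable def minDeg (D : DegreeSequence) : ℕ := ⨅ i, D.deg i

/-- `D` is graphic: some simple graph has degree sequence `D`. -/
def Graphic (D : DegreeSequence) : Prop := (realizations D.deg).Nonempty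

/-- The quantity `∂⁺⁺(D)`: the sum over all perturbations at positions `i ≤ j` of the number of
realizations of the perturbed sequence, divided by the number of realizations of `D`. -/
noncomputable def boundary (D : DegreeSequence) : ℝ :=
  ∑ ij : Fin D.len × Fin D.len with ij.1 ≤ ij.2,
    ((realizations (perturb D.deg ij.1 ij.2)).ncard : ℝ) / ((realizations D.deg).ncard : ℝ)

end DegreeSequence

/-- The simple region of all degree sequences that satisfy a formula `φ` in
`n`, `Σ`, `c₁`, `c₂` (in this order). -/
def simpleRegion (φ : ℕ → ℕ → ℕ → ℕ → Prop) : Set DegreeSequence :=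
  {D | φ D.len D.total D.maxDeg D.minDeg}

/-- A region is fully graphic if each of its sequences is graphic. -/
def FullyGraphic (R : Set DegreeSequence) : Prop := ∀ D ∈ R, D.Graphic

/-- A region is P-stable if `∂⁺⁺` is bounded by a polynomial in the length on the graphic sequences
of the region. -/
def PStable (R : Set DegreeSequence) : Prop :=
  ∃ p : Polynomial ℝ, ∀ D ∈ R, D.Graphic → D.boundary ≤ p.eval (D.len : ℝ)

/-- The Greenhill–Sfragara region: `2 ≤ c₂` and `3 ≤ c₁ ≤ √(Σ / 9)`. -/
noncomputable def regionGS : Set DegreeSequence :=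
  simpleRegion fun _ S c₁ c₂ => 2 ≤ c₂ ∧ 3 ≤ c₁ ∧ (c₁ : ℝ) ≤ √((S : ℝ) / 9)

/-- The region `n ≥ 1 / (2ε²)`, `2 ≤ c₂` and `3 ≤ c₁ ≤ √((1 - ε) Σ)`. It is empty for `1 ≤ ε`. -/
noncomputable def regionGSPlus (ε : ℝ) : Set DegreeSequence :=
  simpleRegion fun n S c₁ c₂ =>
    1 / (2 * ε ^ 2) ≤ (n : ℝ) ∧ 2 ≤ c₂ ∧ 3 ≤ c₁ ∧ (c₁ : ℝ) ≤ √((1 - ε) * (S : ℝ))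

/-! ### Edge moves, their effect on degrees, and edit distance. -/

section Moves

open Finset
open scoped Classical

variable {n : ℕ}

/-! P-stability is a switching argument. If every realization `G` of `D + e_i + e_j` has a
realization of `D` within an edit distance depending only on `ε`, then `G` is recovered from that
realization and the small set of differing pairs, so the ratio of the counts is polynomial in `n`
(`ncard_le_of_close`).

To find such a realization, start from a set `B` whose vertices can be paired along edges to `i` and
`j`, and let it grow in layers: a pivot is a vertex with two non-neighbours in the current layer,
and its neighbours form the next layer. A non-adjacent pair in a layer, or an adjacent pair of
pivots, can be switched to create two surplus degrees, which hinge moves at pivots carry back to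
`B`, where deleting one edge at `i` and one at `j` absorbs them (`Surplus.resolve`). If no short
switching exists, all layers are cliques and all pivot sets independent (`cliqueOn_layer`). Cliques
have at most `M + 1` vertices, where `M` bounds the degrees, whereas double counting
(`growth_bound`) forces each layer to gain a positive proportion of `M`, because `Σ` exceeds `c₁²`
by at least `ε Σ`. Boundedly many layers give a contradiction. If the first layer is too small to
start this, the surplus is first moved to vertices of large degree (`exists_large_degree`).

Full graphicness follows from `c₁(c₁ + 1) ≤ Σ`: a sorted sequence of this kind is majorized by the
degrees of a quasi-complete graph, and hinge moves turn that graph into a realization. Regular and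
nearly regular sequences show that the region is infinite and the inclusion strict. -/

/-- The neighbourhood of `x` as a finset. -/
noncomputable def nbhd (G : SimpleGraph (Fin n)) (x : Fin n) : Finset (Fin n) :=
  univ.filter (G.Adj x)

/-- The vector of vertex degrees. -/
noncomputable def degs (G : SimpleGraph (Fin n)) : Fin n → ℕ := fun x => (nbhd G x).card

theorem mem_nbhd {G : SimpleGraph (Fin n)} {x y : Fin n} : y ∈ nbhd G x ↔ G.Adj x y := by
  simp [nbhd]

theorem mem_realizations {G : SimpleGraph (Fin n)} {f : Fin n → ℕ} :
    G ∈ realizations f ↔ degs G = f := by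
  have h : ∀ x, (G.neighborSet x).ncard = degs G x := by
    intro x
    rw [degs, ← Set.ncard_coe_finset]
    congr 1
    ext y
    simp [nbhd]
  simp only [realizations, Set.mem_ofPred_eq, h, funext_iff]

/-- `G` with the edge `xy` added. -/
def addEdge (G : SimpleGraph (Fin n)) (x y : Fin n) : SimpleGraph (Fin n) :=
  G ⊔ SimpleGraph.edge x y

/-- `G` with the edge `xy` removed. -/
def delEdge (G : SimpleGraph (Fin n)) (x y : Fin n) : SimpleGraph (Fin n) :=
  G \ SimpleGraph.edge x y

theorem addEdge_adj {G : SimpleGraph (Fin n)} {x y a b : Fin n} (h : x ≠ y) :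
    (addEdge G x y).Adj a b ↔ G.Adj a b ∨ (a = x ∧ b = y) ∨ (a = y ∧ b = x) := by
  rw [addEdge, SimpleGraph.sup_adj, SimpleGraph.edge_adj]
  constructor
  · rintro (h | ⟨h, -⟩) <;> tauto
  · rintro (h' | ⟨rfl, rfl⟩ | ⟨rfl, rfl⟩)
    · exact Or.inl h'
    · exact Or.inr ⟨Or.inl ⟨rfl, rfl⟩, h⟩
    · exact Or.inr ⟨Or.inr ⟨rfl, rfl⟩, h.symm⟩

theorem delEdge_adj {G : SimpleGraph (Fin n)} {x y a b : Fin n} :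
    (delEdge G x y).Adj a b ↔ G.Adj a b ∧ ¬ ((a = x ∧ b = y) ∨ (a = y ∧ b = x)) := by
  rw [delEdge, SimpleGraph.sdiff_adj, SimpleGraph.edge_adj]
  constructor
  · rintro ⟨h, h'⟩
    exact ⟨h, fun h'' => h' ⟨h'', h.ne⟩⟩
  · rintro ⟨h, h'⟩
    exact ⟨h, fun h'' => h' h''.1⟩

theorem degs_addEdge {G : SimpleGraph (Fin n)} {x y : Fin n} (hxy : x ≠ y) (h : ¬ G.Adj x y) :
    degs (addEdge G x y) = degs G + Pi.single x 1 + Pi.single y 1 := by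
  funext a
  simp only [degs, Pi.add_apply]
  by_cases hax : a = x
  · subst hax
    have : nbhd (addEdge G a y) a = insert y (nbhd G a) := by
      ext b
      simp only [mem_nbhd, addEdge_adj hxy, mem_insert]
      constructor
      · rintro (h | ⟨-, h⟩ | ⟨h, -⟩)
        · exact Or.inr h
        · exact Or.inl h
        · exact absurd h hxy
      · tauto
    rw [this, card_insert_of_notMem (by rwa [mem_nbhd])]
    simp [hxy]
  · by_cases hay : a = y
    · subst hay
      have : nbhd (addEdge G x a) a = insert x (nbhd G a) := by
        ext b
        simp only [mem_nbhd, addEdge_adj hxy, mem_insert]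
        tauto
      rw [this, card_insert_of_notMem (by rw [mem_nbhd]; exact fun h' => h h'.symm)]
      simp [hax]
    · have : nbhd (addEdge G x y) a = nbhd G a := by
        ext b
        simp only [mem_nbhd, addEdge_adj hxy]
        tauto
      simp [this, hax, hay]

theorem addEdge_delEdge {G : SimpleGraph (Fin n)} {x y : Fin n} (h : G.Adj x y) :
    addEdge (delEdge G x y) x y = G := by
  ext a b
  rw [addEdge_adj h.ne, delEdge_adj]
  constructor
  · rintro (h' | ⟨rfl, rfl⟩ | ⟨rfl, rfl⟩)
    · exact h'.1
    · exact h
    · exact h.symm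
  · tauto

theorem degs_delEdge {G : SimpleGraph (Fin n)} {x y : Fin n} (h : G.Adj x y) :
    degs (delEdge G x y) + Pi.single x 1 + Pi.single y 1 = degs G := by
  have h' : ¬ (delEdge G x y).Adj x y := by
    rw [delEdge_adj]; tauto
  rw [← degs_addEdge h.ne h', addEdge_delEdge h]

/-- The ordered pairs on which `G` and `H` differ. -/
noncomputable def diffPairs (G H : SimpleGraph (Fin n)) : Finset (Fin n × Fin n) :=
  univ.filter fun p => ¬ (G.Adj p.1 p.2 ↔ H.Adj p.1 p.2)

/-- `G` and `H` differ on at most `m` ordered pairs. -/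
def Close (m : ℕ) (G H : SimpleGraph (Fin n)) : Prop := (diffPairs G H).card ≤ m

theorem Close.refl (G : SimpleGraph (Fin n)) : Close 0 G G := by
  simp [Close, diffPairs]

theorem Close.mono {m k : ℕ} (h : m ≤ k) {G H : SimpleGraph (Fin n)} (hc : Close m G H) :
    Close k G H := le_trans hc h

theorem Close.trans {m k : ℕ} {G H K : SimpleGraph (Fin n)} (h₁ : Close m G H) (h₂ : Close k H K) :
    Close (m + k) G K := by
  refine le_trans (card_le_card ?_) ((card_union_le _ _).trans (add_le_add h₁ h₂))
  intro p
  simp only [diffPairs, mem_filter, mem_univ, true_and, mem_union]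
  tauto

theorem close_addEdge (G : SimpleGraph (Fin n)) {x y : Fin n} (h : x ≠ y) :
    Close 2 G (addEdge G x y) := by
  refine le_trans (card_le_card (t := {(x, y), (y, x)}) ?_) card_le_two
  rintro ⟨a, b⟩
  simp only [diffPairs, mem_filter, mem_univ, true_and, addEdge_adj h, mem_insert, mem_singleton,
    Prod.mk.injEq]
  tauto

theorem close_delEdge (G : SimpleGraph (Fin n)) (x y : Fin n) :
    Close 2 G (delEdge G x y) := by
  refine le_trans (card_le_card (t := {(x, y), (y, x)}) ?_) card_le_two
  rintro ⟨a, b⟩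
  simp only [diffPairs, mem_filter, mem_univ, true_and, delEdge_adj, mem_insert, mem_singleton,
    Prod.mk.injEq]
  tauto

/-- `G` with the edge `au` replaced by the edge `ux`. -/
def hinge (G : SimpleGraph (Fin n)) (a u x : Fin n) : SimpleGraph (Fin n) :=
  addEdge (delEdge G a u) u x

theorem hinge_adj {G : SimpleGraph (Fin n)} {a u x p q : Fin n} (h : u ≠ x) :
    (hinge G a u x).Adj p q ↔ (G.Adj p q ∧ ¬ ((p = a ∧ q = u) ∨ (p = u ∧ q = a))) ∨
      (p = u ∧ q = x) ∨ (p = x ∧ q = u) := by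
  rw [hinge, addEdge_adj h, delEdge_adj]

theorem close_hinge (G : SimpleGraph (Fin n)) {a u x : Fin n} (h : u ≠ x) :
    Close 4 G (hinge G a u x) :=
  (close_delEdge G a u).trans (close_addEdge _ h)

theorem degs_hinge {G : SimpleGraph (Fin n)} {a u x : Fin n} (h : u ≠ x) (hau : G.Adj a u)
    (hux : ¬ G.Adj u x) :
    degs (hinge G a u x) + Pi.single a 1 = degs G + Pi.single x 1 := by
  have h₁ := degs_delEdge hau
  have h₂ : degs (hinge G a u x) = _ := degs_addEdge (G := delEdge G a u) h (by
    rw [delEdge_adj]; tauto)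
  rw [h₂, ← h₁]
  funext t
  simp only [Pi.add_apply]
  omega

end Moves

/-! ### Layered switching: carrying surplus degrees back to `i` and `j`. -/

section Layers

open Finset
open scoped Classical

variable {n : ℕ}

/-- The elements of `B` other than `x` that are not adjacent to `x`. -/
noncomputable def nonNbrs (G : SimpleGraph (Fin n)) (B : Finset (Fin n)) (x : Fin n) :
    Finset (Fin n) := B.filter fun b => b ≠ x ∧ ¬ G.Adj x b

/-- The vertices outside `S` with at least two non-neighbours in `B`. -/
noncomputable def outer (G : SimpleGraph (Fin n)) (S B : Finset (Fin n)) : Finset (Fin n) :=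
  univ.filter fun x => x ∉ S ∧ 2 ≤ (nonNbrs G B x).card

/-- `B` together with the neighbours outside `S` of `outer G S B`. -/
noncomputable def expand (G : SimpleGraph (Fin n)) (S B : Finset (Fin n)) : Finset (Fin n) :=
  B ∪ univ.filter fun b => b ∉ S ∧ ∃ a ∈ outer G S B, G.Adj a b

/-- The sets obtained from `B` by iterating `expand`. -/
noncomputable def layer (G : SimpleGraph (Fin n)) (S B : Finset (Fin n)) : ℕ → Finset (Fin n)
  | 0 => B
  | k + 1 => expand G S (layer G S B k)

theorem mem_nonNbrs {G : SimpleGraph (Fin n)} {B : Finset (Fin n)} {x b : Fin n} :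
    b ∈ nonNbrs G B x ↔ b ∈ B ∧ b ≠ x ∧ ¬ G.Adj x b := by
  simp [nonNbrs]

theorem mem_outer {G : SimpleGraph (Fin n)} {S B : Finset (Fin n)} {x : Fin n} :
    x ∈ outer G S B ↔ x ∉ S ∧ 2 ≤ (nonNbrs G B x).card := by
  simp [outer]

theorem mem_expand {G : SimpleGraph (Fin n)} {S B : Finset (Fin n)} {x : Fin n} :
    x ∈ expand G S B ↔ x ∈ B ∨ (x ∉ S ∧ ∃ a ∈ outer G S B, G.Adj a x) := by
  simp [expand]

theorem outer_mono {G : SimpleGraph (Fin n)} {S B B' : Finset (Fin n)} (h : B ⊆ B') :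
    outer G S B ⊆ outer G S B' := by
  intro x hx
  rw [mem_outer] at hx ⊢
  exact ⟨hx.1, hx.2.trans (card_le_card (filter_subset_filter _ h))⟩

theorem layer_subset_succ (G : SimpleGraph (Fin n)) (S B : Finset (Fin n)) (k : ℕ) :
    layer G S B k ⊆ layer G S B (k + 1) := by
  intro x hx
  exact mem_expand.2 (Or.inl hx)

theorem layer_mono (G : SimpleGraph (Fin n)) (S B : Finset (Fin n)) : Monotone (layer G S B) :=
  monotone_nat_of_le_succ (layer_subset_succ G S B)

theorem notMem_of_mem_layer {G : SimpleGraph (Fin n)} {S B : Finset (Fin n)}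
    (hB : ∀ b ∈ B, b ∉ S) : ∀ k, ∀ b ∈ layer G S B k, b ∉ S
  | 0, b, hb => hB b hb
  | k + 1, b, hb => by
    rcases mem_expand.1 hb with h | h
    · exact notMem_of_mem_layer hB k b h
    · exact h.1

/-- Any two distinct vertices of `B` can be matched along edges of `G` to `i` and `j`. -/
def Pairable (G : SimpleGraph (Fin n)) (i j : Fin n) (B : Finset (Fin n)) : Prop :=
  (∀ b ∈ B, b ∉ ({i, j} : Finset (Fin n))) ∧
    ∀ c ∈ B, ∀ c' ∈ B, c ≠ c' → (G.Adj i c ∧ G.Adj j c') ∨ (G.Adj j c ∧ G.Adj i c')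

/-- `H` arises from `G` by moves that leave a surplus at `c` and `c'`, and that have not touched
the pairs between `A` and `B` away from `c` and `c'`, nor the pairs at vertices of `S`. -/
structure Surplus (G : SimpleGraph (Fin n)) (S A B : Finset (Fin n)) (H : SimpleGraph (Fin n))
    (c c' : Fin n) : Prop where
  ne : c ≠ c'
  agree : ∀ y ∈ B, y ≠ c → y ≠ c' → ∀ a ∈ A, (H.Adj a y ↔ G.Adj a y)
  left : ∀ a ∈ A, G.Adj a c → H.Adj a c
  right : ∀ a ∈ A, G.Adj a c' → H.Adj a c'
  special : ∀ s ∈ S, ∀ y, (H.Adj s y ↔ G.Adj s y)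
  degs_eq : degs H = degs G + Pi.single c 1 + Pi.single c' 1

theorem Surplus.symm {G H : SimpleGraph (Fin n)} {S A B : Finset (Fin n)} {c c' : Fin n}
    (h : Surplus G S A B H c c') : Surplus G S A B H c' c where
  ne := h.ne.symm
  agree y hy h₁ h₂ := h.agree y hy h₂ h₁
  left := h.right
  right := h.left
  special := h.special
  degs_eq := by rw [h.degs_eq, add_right_comm]

theorem Surplus.mono {G H : SimpleGraph (Fin n)} {S A B B' : Finset (Fin n)} {c c' : Fin n}
    (h : Surplus G S A B H c c') (hB : B' ⊆ B) : Surplus G S A B' H c c' where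
  ne := h.ne
  agree y hy := h.agree y (hB hy)
  left := h.left
  right := h.right
  special := h.special
  degs_eq := h.degs_eq

/-- A vertex `c` outside `B` was added because of a pivot `a` adjacent to it; replacing the edge
`ac` by an edge from `a` to a non-neighbour in `B` moves the surplus one layer down. The invariants
of `Surplus` guarantee that `H` still looks like `G` at the pairs involved. -/
theorem Surplus.step {G H : SimpleGraph (Fin n)} {S A B : Finset (Fin n)} {c c' : Fin n}
    (h : Surplus G S A B H c c') (hBS : ∀ b ∈ B, b ∉ S) (hA : outer G S B ⊆ A)
    (hAB : ∀ x ∈ A, x ∉ B ∧ x ≠ c ∧ x ≠ c') (hc : c ∈ expand G S B) :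
    ∃ H' c₂, Surplus G S A B H' c₂ c' ∧ c₂ ∈ B ∧ Close 4 H H' := by
  by_cases hcB : c ∈ B
  · exact ⟨H, c, h, hcB, (Close.refl H).mono (by omega)⟩
  obtain ⟨hcS, a, ha, hac⟩ := (mem_expand.1 hc).resolve_left hcB
  have haA := hA ha
  obtain ⟨haS, ha2⟩ := mem_outer.1 ha
  -- This is why pivots need two non-neighbours: one of them avoids the other surplus vertex `c'`.
  obtain ⟨c₂, hc₂, hne⟩ := exists_mem_ne (by omega : 1 < (nonNbrs G B a).card) c'
  obtain ⟨hc₂B, hc₂a, hc₂n⟩ := mem_nonNbrs.1 hc₂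
  have hcc₂ : c₂ ≠ c := fun e => hcB (e ▸ hc₂B)
  have hHac := h.left a haA hac
  have hHac₂ : ¬ H.Adj a c₂ := by rwa [h.agree c₂ hc₂B hcc₂ hne a haA]
  refine ⟨hinge H c a c₂, c₂, ⟨hne, ?_, ?_, ?_, ?_, ?_⟩, hc₂B, close_hinge H hc₂a.symm⟩
  · intro y hy hy₁ hy₂ x hx
    have hyc : y ≠ c := fun e => hcB (e ▸ hy)
    have hya : y ≠ a := fun e => (hAB a haA).1 (e ▸ hy)
    rw [hinge_adj hc₂a.symm, ← h.agree y hy hyc hy₂ x hx]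
    tauto
  · intro x hx hxc
    rw [hinge_adj hc₂a.symm]
    by_cases hxa : x = a
    · exact absurd (hxa ▸ hxc) hc₂n
    by_cases hxc' : x = c
    · exact absurd hxc' (hAB x hx).2.1
    have := (h.agree c₂ hc₂B hcc₂ hne x hx).2 hxc
    tauto
  · intro x hx hxc
    rw [hinge_adj hc₂a.symm]
    have h₁ := h.right x hx hxc
    have h₂ := (hAB x hx).2.1
    have h₃ := h.ne
    tauto
  · intro s hs y
    rw [hinge_adj hc₂a.symm, ← h.special s hs y]
    have h₁ : s ≠ a := fun e => haS (e ▸ hs)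
    have h₂ : s ≠ c := fun e => hcS (e ▸ hs)
    have h₃ : s ≠ c₂ := fun e => hBS _ hc₂B (e ▸ hs)
    tauto
  · have h₁ := degs_hinge hc₂a.symm hHac.symm hHac₂
    rw [h.degs_eq] at h₁
    funext t
    have h₂ := congrFun h₁ t
    simp only [Pi.add_apply] at h₂ ⊢
    omega

/-- Each layer costs at most two hinge moves, hence 8 ordered pairs; the two final deletions at `i`
and `j` cost 4. -/
theorem Surplus.resolve {G : SimpleGraph (Fin n)} {i j : Fin n} {B A : Finset (Fin n)}
    {d : Fin n → ℕ} (hd : degs G = perturb d i j) (hP : Pairable G i j B) :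
    ∀ (k : ℕ) (H : SimpleGraph (Fin n)) (c c' : Fin n),
      Surplus G {i, j} A (layer G {i, j} B k) H c c' → c ∈ layer G {i, j} B k →
      c' ∈ layer G {i, j} B k → (∀ l < k, outer G {i, j} (layer G {i, j} B l) ⊆ A) →
      (∀ x ∈ A, x ∉ layer G {i, j} B k) →
      ∃ H', degs H' = d ∧ Close (8 * k + 4) H H'
  | 0, H, c, c', h, hc, hc', _, _ => by
    have key : ∀ c ∈ B, ∀ c' ∈ B, Surplus G {i, j} A B H c c' → G.Adj i c → G.Adj j c' →
        ∃ H', degs H' = d ∧ Close 4 H H' := by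
      intro c hc c' hc' h hic hjc'
      have h₁ : H.Adj i c := (h.special i (by simp) c).2 hic
      have h₂ : (delEdge H i c).Adj j c' := by
        rw [delEdge_adj]
        refine ⟨(h.special j (by simp) c').2 hjc', ?_⟩
        rintro (⟨-, e⟩ | ⟨e, -⟩)
        · exact h.ne e.symm
        · exact hP.1 c hc (by simp [e])
      refine ⟨delEdge (delEdge H i c) j c', ?_, (close_delEdge _ _ _).trans (close_delEdge _ _ _)⟩
      have e₁ := degs_delEdge h₁
      have e₂ := degs_delEdge h₂
      rw [h.degs_eq, hd] at e₁
      funext t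
      have e₁' := congrFun e₁ t
      have e₂' := congrFun e₂ t
      simp only [Pi.add_apply, perturb] at e₁' e₂'
      omega
    rcases hP.2 c hc c' hc' h.ne with ⟨h₁, h₂⟩ | ⟨h₁, h₂⟩
    · exact key c hc c' hc' h h₁ h₂
    · exact key c' hc' c hc h.symm h₂ h₁
  | k + 1, H, c, c', h, hc, hc', hA, hAB => by
    have hsub := layer_subset_succ G {i, j} B k
    have hBS := notMem_of_mem_layer (G := G) hP.1 k
    have hne : ∀ x ∈ A, ∀ y ∈ layer G {i, j} B (k + 1), x ≠ y :=
      fun x hx y hy e => hAB x hx (e ▸ hy)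
    obtain ⟨H₁, c₁, h₁, hc₁, hcl₁⟩ := (h.mono hsub).step hBS (hA k (by omega))
      (fun x hx => ⟨fun hx' => hAB x hx (hsub hx'), hne x hx c hc, hne x hx c' hc'⟩) hc
    obtain ⟨H₂, c₂, h₂, hc₂, hcl₂⟩ := h₁.symm.step hBS (hA k (by omega))
      (fun x hx => ⟨fun hx' => hAB x hx (hsub hx'), hne x hx c' hc', hne x hx c₁ (hsub hc₁)⟩) hc'
    obtain ⟨H', hH', hcl⟩ := Surplus.resolve hd hP k H₂ c₂ c₁ h₂ hc₂ hc₁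
      (fun l hl => hA l (by omega)) (fun x hx hx' => hAB x hx (hsub hx'))
    exact ⟨H', hH', ((hcl₁.trans hcl₂).trans hcl).mono (by omega)⟩

theorem exists_close_of_not_adj {G : SimpleGraph (Fin n)} {i j : Fin n} {B A : Finset (Fin n)}
    {d : Fin n → ℕ} (hd : degs G = perturb d i j) (hP : Pairable G i j B) {k : ℕ} {b b' : Fin n}
    (hb : b ∈ layer G {i, j} B k) (hb' : b' ∈ layer G {i, j} B k) (hne : b ≠ b')
    (hn : ¬ G.Adj b b') (hA : ∀ l < k, outer G {i, j} (layer G {i, j} B l) ⊆ A)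
    (hAB : ∀ x ∈ A, x ∉ layer G {i, j} B k) :
    ∃ H, degs H = d ∧ Close (8 * k + 10) G H := by
  have hS := notMem_of_mem_layer (G := G) hP.1 k
  have h : Surplus G {i, j} A (layer G {i, j} B k) (addEdge G b b') b b' := by
    have hAne : ∀ a ∈ A, a ≠ b ∧ a ≠ b' :=
      fun a ha => ⟨fun e => hAB a ha (e ▸ hb), fun e => hAB a ha (e ▸ hb')⟩
    refine ⟨hne, ?_, ?_, ?_, ?_, degs_addEdge hne hn⟩
    · intro y _ _ _ a ha
      have := hAne a ha
      rw [addEdge_adj hne]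
      tauto
    · intro a _ h
      exact (addEdge_adj hne).2 (Or.inl h)
    · intro a _ h
      exact (addEdge_adj hne).2 (Or.inl h)
    · intro s hs y
      have h₁ : s ≠ b := fun e => hS b hb (e ▸ hs)
      have h₂ : s ≠ b' := fun e => hS b' hb' (e ▸ hs)
      rw [addEdge_adj hne]
      tauto
  obtain ⟨H, hH, hcl⟩ := Surplus.resolve hd hP k _ b b' h hb hb' hA hAB
  exact ⟨H, hH, ((close_addEdge G hne).trans hcl).mono (by omega)⟩

/-- Trading the edge `aa'` for `ac` and `a'c'`, with distinct non-neighbours `c`, `c'` in the layer,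
keeps the degrees of `a` and `a'` and creates the surplus pair. -/
theorem exists_close_of_adj {G : SimpleGraph (Fin n)} {i j : Fin n} {B : Finset (Fin n)}
    {d : Fin n → ℕ} (hd : degs G = perturb d i j) (hP : Pairable G i j B) {k : ℕ} {a a' : Fin n}
    (ha : a ∈ outer G {i, j} (layer G {i, j} B k)) (ha' : a' ∈ outer G {i, j} (layer G {i, j} B k))
    (haa' : G.Adj a a')
    (hAB : ∀ x ∈ outer G {i, j} (layer G {i, j} B k), x ∉ layer G {i, j} B k) :
    ∃ H, degs H = d ∧ Close (8 * k + 10) G H := by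
  have hS := notMem_of_mem_layer (G := G) hP.1 k
  obtain ⟨haS, ha2⟩ := mem_outer.1 ha
  obtain ⟨haS', ha2'⟩ := mem_outer.1 ha'
  obtain ⟨c, hc⟩ := card_pos.1 (by omega : 0 < (nonNbrs G (layer G {i, j} B k) a).card)
  obtain ⟨c', hc', hne⟩ := exists_mem_ne
    (by omega : 1 < (nonNbrs G (layer G {i, j} B k) a').card) c
  obtain ⟨hcB, hca, hcn⟩ := mem_nonNbrs.1 hc
  obtain ⟨hcB', hca', hcn'⟩ := mem_nonNbrs.1 hc'
  have hAne : ∀ x ∈ outer G {i, j} (layer G {i, j} B k), x ≠ c ∧ x ≠ c' :=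
    fun x hx => ⟨fun e => hAB x hx (e ▸ hcB), fun e => hAB x hx (e ▸ hcB')⟩
  have hac' := (hAne a ha).2
  have ha'c := (hAne a' ha').1
  set H₁ := delEdge G a a' with hH₁
  have hn₁ : ¬ H₁.Adj a c := by rw [hH₁, delEdge_adj]; tauto
  set H₂ := addEdge H₁ a c with hH₂
  have hn₂ : ¬ H₂.Adj a' c' := by
    rw [hH₂, addEdge_adj hca.symm, hH₁, delEdge_adj]
    tauto
  have hadj : ∀ x y, (addEdge H₂ a' c').Adj x y ↔
      ((G.Adj x y ∧ ¬ ((x = a ∧ y = a') ∨ (x = a' ∧ y = a))) ∨ (x = a ∧ y = c) ∨ (x = c ∧ y = a)) ∨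
        (x = a' ∧ y = c') ∨ (x = c' ∧ y = a') := by
    intro x y
    rw [addEdge_adj hca'.symm, hH₂, addEdge_adj hca.symm, hH₁, delEdge_adj]
  have h : Surplus G {i, j} (outer G {i, j} (layer G {i, j} B k)) (layer G {i, j} B k)
      (addEdge H₂ a' c') c c' := by
    refine ⟨hne.symm, ?_, ?_, ?_, ?_, ?_⟩
    · intro y hy hyc hyc' x hx
      have h₁ := hAne x hx
      have h₂ : y ≠ a := fun e => hAB a ha (e ▸ hy)
      have h₃ : y ≠ a' := fun e => hAB a' ha' (e ▸ hy)
      simp [hadj, h₁.1, h₁.2, h₂, h₃, hyc, hyc']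
    · intro x hx h
      simp [hadj, h, ha'c.symm, hca]
    · intro x hx h
      simp [hadj, h, hac'.symm, hca']
    · intro s hs y
      have h₁ : s ≠ a := fun e => haS (e ▸ hs)
      have h₂ : s ≠ a' := fun e => haS' (e ▸ hs)
      have h₃ : s ≠ c := fun e => hS c hcB (e ▸ hs)
      have h₄ : s ≠ c' := fun e => hS c' hcB' (e ▸ hs)
      simp [hadj, h₁, h₂, h₃, h₄]
    · have e₁ : degs H₁ + _ + _ = _ := degs_delEdge haa'
      have e₂ : degs H₂ = _ := degs_addEdge hca.symm hn₁
      have e₃ := degs_addEdge hca'.symm hn₂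
      rw [e₃, e₂, ← e₁]
      funext t
      simp only [Pi.add_apply]
      omega
  obtain ⟨H, hH, hcl⟩ := Surplus.resolve hd hP k _ c c' h hcB hcB'
    (fun l hl => outer_mono (layer_mono _ _ _ hl.le)) hAB
  have hcl₁ := ((close_delEdge G a a').trans (close_addEdge H₁ hca.symm)).trans
    (close_addEdge H₂ hca'.symm)
  exact ⟨H, hH, (hcl₁.trans hcl).mono (by omega)⟩

/-- `B` is a clique of `G`. -/
def CliqueOn (G : SimpleGraph (Fin n)) (B : Finset (Fin n)) : Prop :=
  ∀ b ∈ B, ∀ b' ∈ B, b ≠ b' → G.Adj b b'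

theorem CliqueOn.notMem_of_mem_outer {G : SimpleGraph (Fin n)} {S B : Finset (Fin n)}
    (h : CliqueOn G B) {x : Fin n} (hx : x ∈ outer G S B) : x ∉ B := by
  intro hxB
  obtain ⟨c, hc⟩ := card_pos.1 (by have := (mem_outer.1 hx).2; omega : 0 < (nonNbrs G B x).card)
  obtain ⟨hcB, hcx, hcn⟩ := mem_nonNbrs.1 hc
  exact hcn (h x hxB c hcB hcx.symm)

/-- The two properties feed each other: a clique layer contains none of its pivots, which makes the
switch at adjacent pivots legal; independence of the pivots then keeps them out of the next layer,
which makes the switch at a non-adjacent pair there legal. -/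
theorem cliqueOn_layer {G : SimpleGraph (Fin n)} {i j : Fin n} {B : Finset (Fin n)}
    {d : Fin n → ℕ} (hd : degs G = perturb d i j) (hP : Pairable G i j B) {N : ℕ}
    (hN : ¬ ∃ H, degs H = d ∧ Close (8 * N + 10) G H) :
    ∀ k ≤ N, CliqueOn G (layer G {i, j} B k) ∧
      ∀ a ∈ outer G {i, j} (layer G {i, j} B k), ∀ a' ∈ outer G {i, j} (layer G {i, j} B k),
        ¬ G.Adj a a' := by
  have indep : ∀ k ≤ N, CliqueOn G (layer G {i, j} B k) →
      ∀ a ∈ outer G {i, j} (layer G {i, j} B k), ∀ a' ∈ outer G {i, j} (layer G {i, j} B k),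
        ¬ G.Adj a a' := by
    intro k hk hcl a ha a' ha' h
    obtain ⟨H, hH, hc⟩ := exists_close_of_adj hd hP ha ha' h fun x hx => hcl.notMem_of_mem_outer hx
    exact hN ⟨H, hH, hc.mono (by omega)⟩
  intro k
  induction k with
  | zero =>
    intro hk
    have hcl : CliqueOn G (layer G {i, j} B 0) := by
      intro b hb b' hb' hne
      by_contra h
      obtain ⟨H, hH, hc⟩ := exists_close_of_not_adj (A := ∅) hd hP hb hb' hne h
        (fun l hl => absurd hl (by omega)) (by simp)
      exact hN ⟨H, hH, hc.mono (by omega)⟩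
    exact ⟨hcl, indep 0 hk hcl⟩
  | succ k ih =>
    intro hk
    obtain ⟨h₁, h₂⟩ := ih (by omega)
    have hcl : CliqueOn G (layer G {i, j} B (k + 1)) := by
      intro b hb b' hb' hne
      by_contra h
      obtain ⟨H, hH, hc⟩ := exists_close_of_not_adj
        (A := outer G {i, j} (layer G {i, j} B k)) hd hP hb hb' hne h
        (fun l hl => outer_mono (layer_mono _ _ _ (by omega))) (by
          intro x hx hx'
          rcases mem_expand.1 hx' with h' | ⟨-, a, ha, hax⟩
          · exact h₁.notMem_of_mem_outer hx h'
          · exact h₂ a ha x hx hax)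
      exact hN ⟨H, hH, hc.mono (by omega)⟩
    exact ⟨hcl, indep _ hk hcl⟩

end Layers

/-! ### Double counting: clique layers must keep growing. -/

section Growth

open Finset
open scoped Classical

variable {n : ℕ}

theorem sum_card_inter_comm (G : SimpleGraph (Fin n)) (X Y : Finset (Fin n)) :
    ∑ x ∈ X, (nbhd G x ∩ Y).card = ∑ y ∈ Y, (nbhd G y ∩ X).card := by
  have h : ∀ x, ∀ Z : Finset (Fin n), (nbhd G x ∩ Z).card = ∑ z ∈ Z, if G.Adj x z then 1 else 0 := by
    intro x Z
    rw [← card_filter]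
    congr 1
    ext z
    simp [mem_nbhd, and_comm]
  simp only [h]
  rw [sum_comm]
  simp only [G.adj_comm]

theorem CliqueOn.card_le {G : SimpleGraph (Fin n)} {B : Finset (Fin n)} (h : CliqueOn G B) {M : ℕ}
    (hM : ∀ x, degs G x ≤ M) : B.card ≤ M + 1 := by
  rcases B.eq_empty_or_nonempty with rfl | ⟨b, hb⟩
  · simp
  have h₁ : B.erase b ⊆ nbhd G b := by
    intro x hx
    rw [mem_erase] at hx
    exact mem_nbhd.2 (h b hb x hx.2 hx.1.symm)
  have h₂ := (card_le_card h₁).trans (hM b)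
  rw [card_erase_of_mem hb] at h₂
  omega

theorem sum_outer_eq (G : SimpleGraph (Fin n)) (S B : Finset (Fin n)) :
    ∑ x ∈ outer G S B, degs G x =
      ∑ y ∈ S ∪ expand G S B, (nbhd G y ∩ outer G S B).card := by
  rw [← sum_card_inter_comm]
  refine sum_congr rfl fun x hx => ?_
  have : nbhd G x ⊆ S ∪ expand G S B := by
    intro y hy
    rw [mem_union]
    by_cases hyS : y ∈ S
    · exact Or.inl hyS
    · exact Or.inr (mem_expand.2 (Or.inr ⟨hyS, x, hx, mem_nbhd.1 hy⟩))
  rw [inter_eq_left.2 this, degs]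

/-- Apart from `S`, a vertex is either a pivot, with all neighbours in `S ∪ expand G S B`, or lies
in `C` and has at least `b` neighbours in `B`. Both kinds draw on the at most `(b + 2) M` edge ends
at `B`: an edge end used by `C` accounts for at most `M / b` of the degree sum, one used by pivots
for 1. -/
theorem growth_bound {G : SimpleGraph (Fin n)} {S B : Finset (Fin n)} {M b : ℕ}
    (hM : ∀ x, degs G x ≤ M) (hS : S.card ≤ 2) (hcl : CliqueOn G B) (hb : B.card = b + 2) :
    b * ∑ x, degs G x ≤
      b * (4 * M + (expand G S B \ B).card * M + M ^ 2) + 2 * M ^ 2 := by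
  set A := outer G S B with hA
  set E := expand G S B with hE
  set C := univ.filter fun x => x ∉ S ∧ x ∉ A with hC
  have hBE : B ⊆ E := fun x hx => mem_expand.2 (Or.inl hx)
  have hsum : ∀ X : Finset (Fin n), ∑ x ∈ X, degs G x ≤ X.card * M := fun X =>
    sum_le_card_nsmul _ _ _ fun x _ => hM x
  have hsum' : ∀ X : Finset (Fin n), ∑ x ∈ X, (nbhd G x ∩ A).card ≤ X.card * M := fun X =>
    sum_le_card_nsmul _ _ _ fun x _ => (card_le_card inter_subset_left).trans (hM x)
  have hS2 : S.card * M ≤ 2 * M := Nat.mul_le_mul_right _ hS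
  have h₁ : ∑ x, degs G x ≤ 2 * M + C.card * M + ∑ x ∈ A, degs G x := by
    have : (univ : Finset (Fin n)) ⊆ (S ∪ C) ∪ A := by
      intro x _
      simp only [hC, mem_union, mem_filter, mem_univ, true_and]
      tauto
    have h := sum_le_sum_of_subset (f := degs G) this
    have h' := sum_union_inter (s₁ := S ∪ C) (s₂ := A) (f := degs G)
    have h'' := sum_union_inter (s₁ := S) (s₂ := C) (f := degs G)
    have := hsum S
    have := hsum C
    omega
  have h₂ : ∑ x ∈ A, degs G x ≤ 2 * M + ∑ y ∈ B, (nbhd G y ∩ A).card + (E \ B).card * M := by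
    rw [hA, sum_outer_eq, ← hA, ← hE]
    have h := sum_union_inter (s₁ := S) (s₂ := E) (f := fun y => (nbhd G y ∩ A).card)
    have h' := sum_sdiff (f := fun y => (nbhd G y ∩ A).card) hBE
    have := hsum' S
    have := hsum' (E \ B)
    omega
  have h₃ : ∑ y ∈ B, (nbhd G y ∩ A).card + ∑ y ∈ B, (nbhd G y ∩ C).card ≤ (b + 2) * M := by
    rw [← sum_add_distrib, ← hb]
    refine sum_le_card_nsmul _ _ _ fun y _ => ?_
    rw [← card_union_of_disjoint]
    · exact (card_le_card (union_subset inter_subset_left inter_subset_left)).trans (hM y)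
    · rw [disjoint_left]
      intro x hx hx'
      simp only [hC, mem_inter, mem_filter] at hx hx'
      tauto
  have h₄ : C.card * b ≤ ∑ y ∈ B, (nbhd G y ∩ C).card := by
    rw [sum_card_inter_comm]
    refine card_nsmul_le_sum _ _ _ fun x hx => ?_
    simp only [hC, hA, mem_filter, mem_univ, true_and, mem_outer] at hx
    have hx2 : (nonNbrs G B x).card ≤ 1 := by
      by_contra h
      exact hx.2 ⟨hx.1, by omega⟩
    have hsub : B ⊆ (nbhd G x ∩ B) ∪ (nonNbrs G B x ∪ {x}) := by
      intro y hy
      simp only [mem_union, mem_inter, mem_nbhd, mem_nonNbrs, mem_singleton]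
      tauto
    have h := card_le_card hsub
    have h' := card_union_le (nbhd G x ∩ B) (nonNbrs G B x ∪ {x})
    have h'' := card_union_le (nonNbrs G B x) {x}
    rw [card_singleton] at h''
    omega
  have h₅ : b ≤ M := by
    have := hcl.card_le hM
    omega
  generalize ∑ y ∈ B, (nbhd G y ∩ A).card = P at *
  generalize ∑ y ∈ B, (nbhd G y ∩ C).card = Q at *
  generalize (E \ B).card = Δ at *
  generalize C.card = γ at *
  have h₆ : ∑ x, degs G x ≤ 4 * M + γ * M + P + Δ * M := by omega
  generalize ∑ x, degs G x = T at *
  -- With `M = b + e`, what remains is `γ b M + b P ≤ M (Q + P) ≤ (b + 2) M²`, which uses `b ≤ M`.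
  obtain ⟨e, rfl⟩ := Nat.exists_eq_add_of_le h₅
  have h₇ : γ * b * e ≤ Q * e := Nat.mul_le_mul_right _ h₄
  have h₈ : (P + Q) * (b + e) ≤ (b + 2) * (b + e) * (b + e) := Nat.mul_le_mul_right _ h₃
  have h₉ : b * T ≤ b * (4 * (b + e) + γ * (b + e) + P + Δ * (b + e)) := Nat.mul_le_mul_left _ h₆
  have h₁₀ : γ * b * b ≤ Q * b := Nat.mul_le_mul_right _ h₄
  have h₁₁ : 0 ≤ P * e := Nat.zero_le _
  nlinarith

/-- Otherwise every layer from `k` on gains more than `δ` vertices, and after `N` rounds the clique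
is larger than the degree bound permits. -/
theorem exists_close_of_growth {G : SimpleGraph (Fin n)} {i j : Fin n} {B : Finset (Fin n)}
    {d : Fin n → ℕ} (hd : degs G = perturb d i j) (hP : Pairable G i j B) {M b δ N k : ℕ}
    (hM : ∀ x, degs G x ≤ M) (hb : b + 2 ≤ (layer G {i, j} B k).card)
    (hT : b * (4 * M + δ * M + M ^ 2) + 2 * M ^ 2 < b * ∑ x, degs G x)
    (hN : M + 1 < N * (δ + 1)) :
    ∃ H, degs H = d ∧ Close (8 * (k + N) + 10) G H := by
  by_contra hcon
  have hcl := cliqueOn_layer hd hP hcon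
  have hgrow : ∀ t ≤ N, t * (δ + 1) ≤ (layer G {i, j} B (k + t)).card := by
    intro t
    induction t with
    | zero => simp
    | succ t ih =>
      intro ht
      have ih' := ih (by omega)
      have hsub := layer_subset_succ G {i, j} B (k + t)
      have hcard : b + 2 ≤ (layer G {i, j} B (k + t)).card :=
        hb.trans (card_le_card (layer_mono _ _ _ (by omega)))
      obtain ⟨b', hb'⟩ := Nat.exists_eq_add_of_le' (show 2 ≤ (layer G {i, j} B (k + t)).card by omega)
      have hg := growth_bound hM (card_le_two (a := i) (b := j)) (hcl (k + t) (by omega)).1 hb'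
      have hΔ : (layer G {i, j} B (k + (t + 1))).card =
          (layer G {i, j} B (k + t)).card +
            (expand G {i, j} (layer G {i, j} B (k + t)) \ layer G {i, j} B (k + t)).card := by
        rw [add_comm (card _), ← add_assoc]
        exact (card_sdiff_add_card_eq_card hsub).symm
      generalize (expand G {i, j} (layer G {i, j} B (k + t)) \ layer G {i, j} B (k + t)).card = Δ
        at hg hΔ
      have hδ : δ < Δ := by
        by_contra h
        have h₁ : Δ * M ≤ δ * M := Nat.mul_le_mul_right _ (by omega)
        have h₂ : b' * (4 * M + Δ * M + M ^ 2) ≤ b' * (4 * M + δ * M + M ^ 2) :=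
          Nat.mul_le_mul_left _ (by omega)
        have h₅ := hg.trans (Nat.add_le_add_right h₂ _)
        generalize 4 * M + δ * M + M ^ 2 = X at *
        -- `hT` is stated for `b`, but the layer may be larger; since `hT` forces `X` to be at most
        -- the degree sum, adding `r` copies of that inequality extends it to `b + r`.
        obtain ⟨r, rfl⟩ : ∃ r, b' = b + r := Nat.exists_eq_add_of_le (by omega)
        have h₃ : X ≤ ∑ x, degs G x := by
          by_contra h'
          have : b * ∑ x, degs G x ≤ b * X := Nat.mul_le_mul_left _ (by omega)
          omega
        have h₄ : r * X ≤ r * ∑ x, degs G x := Nat.mul_le_mul_left _ h₃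
        rw [add_mul, add_mul] at h₅
        omega
      rw [hΔ, add_mul]
      omega
  have h₁ := hgrow N le_rfl
  have h₂ := (hcl (k + N) le_rfl).1.card_le hM
  omega

end Growth

/-! ### Finding an initial set large enough for the growth argument. -/

section Start

open Finset
open scoped Classical

variable {n : ℕ}

theorem sum_outer_le {G : SimpleGraph (Fin n)} {S B : Finset (Fin n)} {M : ℕ}
    (hM : ∀ x, degs G x ≤ M) (hS : S.card ≤ 2) :
    ∑ x ∈ outer G S B, degs G x ≤ ((expand G S B).card + 2) * M := by
  rw [sum_outer_eq]
  refine (sum_le_card_nsmul _ _ M fun x _ =>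
    (card_le_card inter_subset_left).trans (hM x)).trans ?_
  rw [smul_eq_mul]
  refine Nat.mul_le_mul_right _ ((card_union_le _ _).trans ?_)
  omega

theorem sum_perturb (d : Fin n → ℕ) (i j : Fin n) : ∑ t, perturb d i j t = ∑ t, d t + 2 := by
  simp [perturb, sum_add_distrib]

theorem perturb_le (d : Fin n → ℕ) (i j t : Fin n) : perturb d i j t ≤ d t + 2 := by
  have h : ∀ z : Fin n, (Pi.single z 1 : Fin n → ℕ) t ≤ 1 := by
    intro z
    rw [Pi.single_apply]
    split_ifs <;> simp
  have := h i
  have := h j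
  simp only [perturb, Pi.add_apply]
  omega

/-- A vertex adjacent to neither `u` nor `v` is a pivot for `{u, v}` unless it is one of the four
special vertices, and pivots carry little degree when the expansion is small. The neighbours of `u`
carry at most `M²`, so too much degree would be missing if the remaining neighbours of `v` all had
small degree. -/
theorem exists_large_degree {G : SimpleGraph (Fin n)} {i j u v : Fin n} {M b : ℕ}
    (hM : ∀ x, degs G x ≤ M) (huv : u ≠ v)
    (hb : (expand G {i, j} {u, v}).card < b + 2)
    (hT : M ^ 2 + (2 * b + 9) * M < ∑ x, degs G x) :
    ∃ x, x ∉ ({i, j} : Finset (Fin n)) ∧ x ≠ u ∧ x ≠ v ∧ ¬ G.Adj u x ∧ b + 2 ≤ degs G x := by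
  by_contra! hcon
  set W := (nbhd G v).filter fun x => x ∉ ({i, j} : Finset (Fin n)) ∧ x ≠ u ∧ x ≠ v ∧ ¬ G.Adj u x
    with hW
  have hcover : (univ : Finset (Fin n)) ⊆
      ((nbhd G u ∪ ({i, j} ∪ {u, v})) ∪ outer G {i, j} {u, v}) ∪ W := by
    intro x _
    by_contra hx
    simp only [hW, mem_union, mem_filter, mem_nbhd, not_or] at hx
    obtain ⟨⟨⟨h₁, h₂, h₃⟩, h₄⟩, h₅⟩ := hx
    have hxu : x ≠ u := fun e => h₃ (by simp [e])
    have hxv : x ≠ v := fun e => h₃ (by simp [e])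
    have h₆ : ¬ G.Adj v x := fun h => h₅ ⟨h, h₂, hxu, hxv, h₁⟩
    refine h₄ (mem_outer.2 ⟨h₂, ?_⟩)
    have : {u, v} ⊆ nonNbrs G {u, v} x := by
      intro y hy
      refine mem_nonNbrs.2 ⟨hy, ?_⟩
      rw [mem_insert, mem_singleton] at hy
      rcases hy with rfl | rfl
      · exact ⟨hxu.symm, fun h => h₁ h.symm⟩
      · exact ⟨hxv.symm, fun h => h₆ h.symm⟩
    exact (card_pair huv).symm.le.trans (card_le_card this)
  have hU : ∀ X Y : Finset (Fin n), ∑ x ∈ X ∪ Y, degs G x ≤ ∑ x ∈ X, degs G x + ∑ x ∈ Y, degs G x := by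
    intro X Y
    have := sum_union_inter (s₁ := X) (s₂ := Y) (f := degs G)
    omega
  have hsum : ∀ X : Finset (Fin n), ∑ x ∈ X, degs G x ≤ X.card * M := fun X =>
    sum_le_card_nsmul _ _ _ fun x _ => hM x
  have h₁ := sum_le_sum_of_subset (f := degs G) hcover
  have h₂ := hU ((nbhd G u ∪ ({i, j} ∪ {u, v})) ∪ outer G {i, j} {u, v}) W
  have h₃ := hU (nbhd G u ∪ ({i, j} ∪ {u, v})) (outer G {i, j} {u, v})
  have h₄ := hU (nbhd G u) ({i, j} ∪ {u, v})
  have h₅ : ∑ x ∈ nbhd G u, degs G x ≤ M * M := (hsum _).trans (Nat.mul_le_mul_right _ (hM u))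
  have h₆ : ∑ x ∈ ({i, j} ∪ {u, v} : Finset (Fin n)), degs G x ≤ 4 * M := by
    refine (hsum _).trans (Nat.mul_le_mul_right _ ((card_union_le _ _).trans ?_))
    exact add_le_add card_le_two card_le_two
  have h₇ : ∑ x ∈ outer G {i, j} {u, v}, degs G x ≤ (b + 3) * M :=
    (sum_outer_le hM card_le_two).trans (Nat.mul_le_mul_right _ (by omega))
  have h₈ : ∑ x ∈ W, degs G x ≤ M * (b + 2) := by
    refine (sum_le_card_nsmul _ _ (b + 2) fun x hx => ?_).trans
      (Nat.mul_le_mul_right _ ((card_le_card (filter_subset _ _)).trans (hM v)))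
    obtain ⟨-, h, h', h'', h'''⟩ := mem_filter.1 hx
    exact (hcon x h h' h'' h''').le
  nlinarith

/-- If both surpluses sit at `x`, its whole neighbourhood is pairable. Otherwise either a hinge move
brings the surplus of `y` over to `x`, or every neighbour of `y` other than `x` is also a neighbour
of `x`, and these common neighbours are pairable. -/
theorem exists_close_of_large_degree {G : SimpleGraph (Fin n)} {x y : Fin n} {d : Fin n → ℕ}
    {M b δ N : ℕ} (hd : degs G = perturb d x y) (hM : ∀ x, d x + 2 ≤ M) (hx : b + 2 ≤ d x)
    (hy : b + 2 ≤ d y)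
    (hT : b * (4 * M + δ * M + M ^ 2) + 2 * M ^ 2 < b * (∑ x, d x + 2))
    (hN : M + 1 < N * (δ + 1)) :
    ∃ H, degs H = d ∧ Close (8 * N + 14) G H := by
  have key : ∀ G x y B, degs G = perturb d x y → Pairable G x y B → b + 2 ≤ B.card →
      ∃ H, degs H = d ∧ Close (8 * N + 10) G H := by
    intro G x y B hd hP hB
    obtain ⟨H, hH, hc⟩ := exists_close_of_growth (k := 0) hd hP
      (fun t => (congrFun hd t).le.trans ((perturb_le d x y t).trans (hM t))) hB
      (by rw [hd, sum_perturb]; exact hT) hN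
    exact ⟨H, hH, hc.mono (by omega)⟩
  have double : ∀ G, degs G = perturb d x x → ∃ H, degs H = d ∧ Close (8 * N + 10) G H := by
    intro G hd
    refine key G x x (nbhd G x) hd ⟨?_, ?_⟩ ?_
    · intro c hc
      simpa using (mem_nbhd.1 hc).ne.symm
    · intro c hc c' hc' _
      exact Or.inl ⟨mem_nbhd.1 hc, mem_nbhd.1 hc'⟩
    · have := congrFun hd x
      simp only [perturb, Pi.add_apply, degs] at this
      omega
  by_cases hxy : x = y
  · subst hxy
    obtain ⟨H, hH, hc⟩ := double G hd
    exact ⟨H, hH, hc.mono (by omega)⟩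
  by_cases hex : ∃ c, G.Adj y c ∧ c ≠ x ∧ ¬ G.Adj c x
  · obtain ⟨c, hyc, hcx, hn⟩ := hex
    have hdeg := degs_hinge hcx hyc hn
    obtain ⟨H, hH, hc⟩ := double (hinge G y c x) (by
      funext t
      have := congrFun hdeg t
      rw [hd] at this
      simp only [perturb, Pi.add_apply] at this ⊢
      omega)
    exact ⟨H, hH, ((close_hinge G hcx).trans hc).mono (by omega)⟩
  · push Not at hex
    suffices h : ∃ H, degs H = d ∧ Close (8 * N + 10) G H by
      obtain ⟨H, hH, hc⟩ := h
      exact ⟨H, hH, hc.mono (by omega)⟩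
    refine key G x y ((nbhd G y).erase x) hd ⟨?_, ?_⟩ ?_
    · intro c hc
      rw [mem_erase, mem_nbhd] at hc
      simp [hc.1, hc.2.ne.symm]
    · intro c hc c' hc' _
      rw [mem_erase, mem_nbhd] at hc hc'
      exact Or.inl ⟨(hex c hc.2 hc.1).symm, hc'.2⟩
    · have h₁ := congrFun hd y
      have h₂ := pred_card_le_card_erase (s := nbhd G y) (a := x)
      simp only [perturb, Pi.add_apply, degs, Pi.single_eq_same] at h₁
      omega

theorem exists_close {G : SimpleGraph (Fin n)} {i j : Fin n} {d : Fin n → ℕ}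
    {M b δ N : ℕ} (hd : degs G = perturb d i j) (hM : ∀ x, d x + 2 ≤ M) (hm : ∀ x, 2 ≤ d x)
    (hT : b * (4 * M + δ * M + M ^ 2) + 2 * M ^ 2 < b * (∑ x, d x + 2))
    (hN : M + 1 < N * (δ + 1)) (hQ : M ^ 2 + (2 * b + 9) * M < ∑ x, d x + 2) :
    ∃ H, degs H = d ∧ Close (8 * N + 22) G H := by
  have hsum : ∑ t, degs G t = ∑ t, d t + 2 := by
    rw [hd, sum_perturb]
  have hmax : ∀ t, degs G t ≤ M := fun t =>
    (congrFun hd t).le.trans ((perturb_le d i j t).trans (hM t))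
  have hi : 3 ≤ (nbhd G i).card := by
    have h₁ := congrFun hd i
    have h₂ := hm i
    simp only [perturb, Pi.add_apply, degs, Pi.single_eq_same] at h₁
    omega
  have hj : 3 ≤ (nbhd G j).card := by
    have h₁ := congrFun hd j
    have h₂ := hm j
    simp only [perturb, Pi.add_apply, degs, Pi.single_eq_same] at h₁
    omega
  -- Minimum degree 2 plus the surplus gives `i` and `j` three neighbours each, enough to choose `u
  -- ≠ v` outside `{i, j}`.
  obtain ⟨u, hu, huj⟩ := exists_mem_ne (by omega : 1 < (nbhd G i).card) j
  obtain ⟨v, hv, hv'⟩ := exists_mem_notMem_of_card_lt_card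
    (lt_of_le_of_lt (card_le_two (a := i) (b := u)) (by omega : 2 < (nbhd G j).card))
  rw [mem_nbhd] at hu hv
  rw [mem_insert, mem_singleton, not_or] at hv'
  obtain ⟨hvi, hvu⟩ := hv'
  by_cases hb : b + 2 ≤ (layer G {i, j} {u, v} 1).card
  · have hP : Pairable G i j {u, v} := by
      refine ⟨?_, ?_⟩
      · intro c hc
        rw [mem_insert, mem_singleton] at hc
        rcases hc with rfl | rfl
        · simp [huj, hu.ne.symm]
        · simp [hvi, hv.ne.symm]
      · intro c hc c' hc' hne
        rw [mem_insert, mem_singleton] at hc hc'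
        rcases hc with rfl | rfl <;> rcases hc' with rfl | rfl
        · exact absurd rfl hne
        · exact Or.inl ⟨hu, hv⟩
        · exact Or.inr ⟨hv, hu⟩
        · exact absurd rfl hne
    obtain ⟨H, hH, hc⟩ := exists_close_of_growth hd hP hmax hb (by rw [hsum]; exact hT) hN
    exact ⟨H, hH, hc.mono (by omega)⟩
  · have hb' : (expand G {i, j} {u, v}).card < b + 2 := not_le.1 hb
    -- Two hinge moves, through `u` and through `v`, transfer the surpluses from `i` and `j` to
    -- large-degree vertices `x` and `y`, possibly equal.
    obtain ⟨x, hxS, hxu, hxv, hux, hx⟩ := exists_large_degree hmax (Ne.symm hvu) hb'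
      (by rw [hsum]; exact hQ)
    obtain ⟨y, hyS, hyv, -, hvy, hy⟩ := exists_large_degree (i := i) (j := j) (b := b) hmax hvu
      (by rwa [pair_comm v u]) (by rw [hsum]; exact hQ)
    have hdx : ∀ z, z ∉ ({i, j} : Finset (Fin n)) → degs G z = d z := by
      intro z hz
      rw [mem_insert, mem_singleton, not_or] at hz
      simp [hd, perturb, hz.1, hz.2]
    have e₁ := degs_hinge (Ne.symm hxu) hu hux
    have hjv : (hinge G i u x).Adj j v := by
      rw [hinge_adj (Ne.symm hxu)]
      refine Or.inl ⟨hv, ?_⟩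
      rintro (⟨-, e⟩ | ⟨e, -⟩)
      · exact hvu e
      · exact huj e.symm
    have hvy' : ¬ (hinge G i u x).Adj v y := by
      rw [hinge_adj (Ne.symm hxu)]
      rintro (h | ⟨e, -⟩ | ⟨e, -⟩)
      · exact hvy h.1
      · exact hvu e
      · exact hxv e.symm
    have e₂ := degs_hinge (Ne.symm hyv) hjv hvy'
    obtain ⟨H, hH, hc⟩ := exists_close_of_large_degree
      (G := hinge (hinge G i u x) j v y) (x := x) (y := y) (d := d) (by
        funext t
        have h₁ := congrFun e₁ t
        have h₂ := congrFun e₂ t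
        rw [hd] at h₁
        simp only [perturb, Pi.add_apply] at h₁ h₂ ⊢
        omega) hM (by rw [← hdx x hxS]; exact hx) (by rw [← hdx y hyS]; exact hy) hT hN
    exact ⟨H, hH, (((close_hinge G (Ne.symm hxu)).trans
      (close_hinge _ (Ne.symm hyv))).trans hc).mono (by omega)⟩

end Start

/-! ### From bounded edit distance to a polynomial bound. -/

section Counting

open Finset
open scoped Classical

theorem card_finset_card_le (α : Type*) [Fintype α] (m : ℕ) :
    {s : Finset α | s.card ≤ m}.ncard ≤ (Fintype.card α + 1) ^ m := by
  have h : {s : Finset α | s.card ≤ m}.ncard ≤ (Set.univ : Set (Fin m → Option α)).ncard := by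
    -- A set is encoded by its list of elements padded with `none` to length `m`.
    refine Set.ncard_le_ncard_of_injOn (fun s t => s.toList[t.1]?) (fun _ _ => Set.mem_univ _) ?_
    intro s hs t ht hst
    have hs' : s.card ≤ m := hs
    have ht' : t.card ≤ m := ht
    have hl : s.toList = t.toList := by
      refine List.ext_getElem? fun k => ?_
      by_cases hk : k < m
      · exact congrFun hst ⟨k, hk⟩
      · rw [List.getElem?_eq_none (by rw [length_toList]; omega),
          List.getElem?_eq_none (by rw [length_toList]; omega)]
    ext x
    rw [← mem_toList, hl, mem_toList]
  refine h.trans ?_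
  rw [Set.ncard_univ, Nat.card_eq_fintype_card]
  simp

variable {n : ℕ}

theorem eq_of_diffPairs_eq {G G' H : SimpleGraph (Fin n)} (h : diffPairs G H = diffPairs G' H) :
    G = G' := by
  ext a b
  have := congrArg (fun s => (a, b) ∈ s) h
  simp only [diffPairs, mem_filter, mem_univ, true_and, eq_iff_iff] at this
  tauto

/-- A graph is determined by a nearby graph in `R'` together with the pairs on which they differ. -/
theorem ncard_le_of_close {R R' : Set (SimpleGraph (Fin n))} {m : ℕ}
    (h : ∀ G ∈ R, ∃ H ∈ R', Close m G H) : R.ncard ≤ (n * n + 1) ^ m * R'.ncard := by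
  choose! F hF hc using h
  have h₁ : R.ncard ≤ (R' ×ˢ {s : Finset (Fin n × Fin n) | s.card ≤ m}).ncard := by
    refine Set.ncard_le_ncard_of_injOn (fun G => (F G, diffPairs G (F G))) ?_ ?_
    · intro G hG
      exact ⟨hF G hG, hc G hG⟩
    · intro G _ G' _ hGG'
      simp only [Prod.mk.injEq] at hGG'
      rw [hGG'.1] at hGG'
      exact eq_of_diffPairs_eq hGG'.2
  rw [Set.ncard_prod] at h₁
  have h₂ := card_finset_card_le (Fin n × Fin n) m
  rw [Fintype.card_prod, Fintype.card_fin] at h₂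
  rw [mul_comm]
  exact h₁.trans (Nat.mul_le_mul_left _ h₂)

theorem ncard_realizations_le (f : Fin n → ℕ) :
    (realizations f).ncard ≤ (n * n + 1) ^ (n * n) := by
  have h := ncard_le_of_close (R := realizations f) (R' := {⊥}) (m := n * n) fun G _ =>
    ⟨⊥, rfl, by simpa [Close] using card_le_univ (diffPairs G ⊥)⟩
  simpa using h

theorem boundary_le {D : DegreeSequence} {C : ℝ} (hC : 0 ≤ C)
    (h : ∀ i j, ((realizations (perturb D.deg i j)).ncard : ℝ) ≤ C * (realizations D.deg).ncard) :
    D.boundary ≤ (D.len : ℝ) ^ 2 * C := by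
  have h₁ : ∀ ij : Fin D.len × Fin D.len,
      ((realizations (perturb D.deg ij.1 ij.2)).ncard : ℝ) / ((realizations D.deg).ncard : ℝ) ≤ C :=
    fun ij => div_le_of_le_mul₀ (Nat.cast_nonneg _) hC (h ij.1 ij.2)
  refine (sum_le_card_nsmul _ _ C fun ij _ => h₁ ij).trans ?_
  rw [nsmul_eq_mul]
  refine mul_le_mul_of_nonneg_right ?_ hC
  have h₂ := card_filter_le (univ : Finset (Fin D.len × Fin D.len)) (fun ij => ij.1 ≤ ij.2)
  rw [card_univ, Fintype.card_prod, Fintype.card_fin, ← sq] at h₂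
  exact_mod_cast h₂

theorem boundary_le_of_close {D : DegreeSequence} {m : ℕ}
    (h : ∀ i j G, degs G = perturb D.deg i j → ∃ H, degs H = D.deg ∧ Close m G H) :
    D.boundary ≤ (D.len : ℝ) ^ 2 * ((D.len : ℝ) * D.len + 1) ^ m := by
  refine boundary_le (by positivity) fun i j => ?_
  have := ncard_le_of_close (R := realizations (perturb D.deg i j)) (R' := realizations D.deg)
    (m := m) fun G hG => by
      obtain ⟨H, hH, hc⟩ := h i j G (mem_realizations.1 hG)
      exact ⟨H, mem_realizations.2 hH, hc⟩
  exact_mod_cast this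

theorem boundary_le_of_graphic {D : DegreeSequence} (hD : D.Graphic) :
    D.boundary ≤ (D.len : ℝ) ^ 2 * ((D.len : ℝ) * D.len + 1) ^ (D.len * D.len) := by
  refine boundary_le (by positivity) fun i j => ?_
  have h₁ := ncard_realizations_le (perturb D.deg i j)
  have h₂ : 1 ≤ (realizations D.deg).ncard := (Set.ncard_pos (Set.toFinite _)).2 hD
  have h₃ := h₁.trans (Nat.le_mul_of_pos_right _ h₂)
  exact_mod_cast h₃

theorem DegreeSequence.deg_le_maxDeg (D : DegreeSequence) (i : Fin D.len) : D.deg i ≤ D.maxDeg :=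
  le_ciSup (Set.finite_range D.deg).bddAbove i

theorem DegreeSequence.minDeg_le_deg (D : DegreeSequence) (i : Fin D.len) : D.minDeg ≤ D.deg i :=
  ciInf_le (Set.finite_range D.deg).bddBelow i

theorem DegreeSequence.len_mul_minDeg_le (D : DegreeSequence) : D.len * D.minDeg ≤ D.total := by
  have := card_nsmul_le_sum univ D.deg D.minDeg fun i _ => D.minDeg_le_deg i
  simpa [DegreeSequence.total] using this

theorem sq_le_of_mem_regionGSPlus {ε : ℝ} {D : DegreeSequence} (hD : D ∈ regionGSPlus ε) :
    (D.maxDeg : ℝ) ^ 2 ≤ (1 - ε) * D.total ∧ ε < 1 := by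
  obtain ⟨-, -, h₃, h₄⟩ := hD
  have h₅ : (3 : ℝ) ≤ D.maxDeg := by exact_mod_cast h₃
  have hpos : 0 < (1 - ε) * (D.total : ℝ) := Real.sqrt_pos.1 (by linarith)
  refine ⟨?_, ?_⟩
  · calc (D.maxDeg : ℝ) ^ 2 ≤ √((1 - ε) * D.total) ^ 2 := by gcongr
      _ = _ := Real.sq_sqrt hpos.le
  · have : 0 < 1 - ε := pos_of_mul_pos_left hpos (Nat.cast_nonneg _)
    linarith

/-- Beyond a length that depends on `ε` only, all realizations of perturbed sequences of the region
are within bounded edit distance of realizations of the sequence itself. -/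
theorem exists_close_of_mem_region {ε : ℝ} (hε : 0 < ε) : ∃ n₀ m : ℕ, ∀ D ∈ regionGSPlus ε,
    n₀ ≤ D.len → ∀ i j G, degs G = perturb D.deg i j → ∃ H, degs H = D.deg ∧ Close m G H := by
  obtain ⟨q, hq⟩ := exists_nat_ge (32 / ε)
  refine ⟨(2 * q + 40) ^ 2 * q ^ 2, 8 * q + 22, ?_⟩
  intro D hD hlen i j G hG
  obtain ⟨hsq, hε1⟩ := sq_le_of_mem_regionGSPlus hD
  obtain ⟨-, hmin, -, -⟩ := hD
  have hqε : 32 ≤ ε * q := by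
    rw [div_le_iff₀ hε] at hq
    linarith
  have hq32 : (32 : ℝ) ≤ q := by nlinarith [Nat.cast_nonneg (α := ℝ) q]
  set c := D.maxDeg with hc
  set S : ℝ := (D.total : ℝ) with hS
  set r := √S with hr
  have hS0 : 0 ≤ S := Nat.cast_nonneg _
  have hrS : r ^ 2 = S := Real.sq_sqrt hS0
  have hr0 : 0 ≤ r := Real.sqrt_nonneg _
  have hcr : (c : ℝ) ≤ r := by
    refine Real.le_sqrt_of_sq_le (hsq.trans ?_)
    nlinarith
  have htot : D.len ≤ D.total :=
    (Nat.le_mul_of_pos_right _ (by omega)).trans D.len_mul_minDeg_le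
  have hrbig : (2 * q + 40) * q ≤ r := by
    refine Real.le_sqrt_of_sq_le ?_
    rw [mul_pow, hS]
    exact_mod_cast hlen.trans htot
  -- the slack `ε S` dominates all terms that are linear in `r`
  have hslack : (64 * q + 1280) * r ≤ ε * S := by
    have h₁ : 32 * ((2 * q + 40) : ℝ) ≤ ε * r := by
      have : ε * ((2 * q + 40) * q) ≤ ε * r := mul_le_mul_of_nonneg_left hrbig hε.le
      nlinarith
    rw [← hrS]
    nlinarith
  have hr1 : 1 ≤ r := by nlinarith
  set M := c + 2 with hM
  have hMr : (M : ℝ) = c + 2 := by rw [hM]; push_cast; ring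
  have hM2 : (M : ℝ) ^ 2 ≤ (1 - ε) * S + 8 * r := by
    rw [hMr]; nlinarith
  have hMle : (M : ℝ) ≤ 3 * r := by rw [hMr]; linarith
  -- Each layer should gain about `ε M / 16` vertices. As `ε q ≥ 32`, `q` rounds gain more than `2 M
  -- ≥ M + 1`, and taking `b = q` reduces `2 M² / b` to at most `ε M² / 16`. The slack `ε Σ` pays
  -- for these and for the terms linear in `M`.
  obtain ⟨δ, hδ⟩ : ∃ δ : ℕ, δ = ⌊ε * M / 16⌋₊ := ⟨_, rfl⟩
  have hδ₁ : (δ : ℝ) ≤ ε * M / 16 := by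
    rw [hδ]; exact Nat.floor_le (by positivity)
  have hδ₂ : ε * M / 16 < δ + 1 := by
    rw [hδ]; exact Nat.lt_floor_add_one _
  have hMpos : (2 : ℝ) ≤ M := by rw [hMr]; linarith [Nat.cast_nonneg (α := ℝ) c]
  refine exists_close (M := M) (b := q) (δ := δ) (N := q) hG ?_ ?_ ?_ ?_ ?_
  · intro x
    have := D.deg_le_maxDeg x
    omega
  · exact fun x => hmin.trans (D.minDeg_le_deg x)
  · have hX : (q : ℝ) * (4 * M + δ * M + M ^ 2) + 2 * M ^ 2 < q * (S + 2) := by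
      have h₁ : (δ : ℝ) * M ≤ ε * M ^ 2 / 16 := by nlinarith
      have h₂ : (2 : ℝ) * M ^ 2 ≤ q * (ε * M ^ 2 / 16) := by nlinarith [sq_nonneg (M : ℝ)]
      have h₃ : 4 * (M : ℝ) + ε * M ^ 2 / 16 + M ^ 2 + ε * M ^ 2 / 16 < S + 2 := by
        have h₄ : ε * M ^ 2 ≤ ε * ((1 - ε) * S + 8 * r) := mul_le_mul_of_nonneg_left hM2 hε.le
        have h₅ : ε * ((1 - ε) * S + 8 * r) ≤ ε * S + 8 * r := by nlinarith [mul_nonneg hε.le hS0]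
        nlinarith
      nlinarith
    rw [hS] at hX
    change _ < q * (D.total + 2)
    exact_mod_cast hX
  · have hX : (M : ℝ) + 1 < q * (δ + 1) := by nlinarith
    exact_mod_cast hX
  · have hX : (M : ℝ) ^ 2 + (2 * q + 9) * M < S + 2 := by nlinarith
    rw [hS] at hX
    change _ < D.total + 2
    exact_mod_cast hX

theorem pStable_regionGSPlus {ε : ℝ} (hε : 0 < ε) : PStable (regionGSPlus ε) := by
  obtain ⟨n₀, m, h⟩ := exists_close_of_mem_region hε
  -- The constant term covers the lengths up to `n₀`, where the trivial bound on the number of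
  -- realizations suffices.
  refine ⟨Polynomial.X ^ 2 * (Polynomial.X * Polynomial.X + 1) ^ m +
    Polynomial.C ((n₀ : ℝ) ^ 2 * ((n₀ : ℝ) * n₀ + 1) ^ (n₀ * n₀)), fun D hD hg => ?_⟩
  simp only [Polynomial.eval_add, Polynomial.eval_mul, Polynomial.eval_pow, Polynomial.eval_X,
    Polynomial.eval_one, Polynomial.eval_C]
  rcases le_total n₀ D.len with hn | hn
  · exact (boundary_le_of_close (h D hD hn)).trans (le_add_of_nonneg_right (by positivity))
  · refine (boundary_le_of_graphic hg).trans (le_trans ?_ (le_add_of_nonneg_left (by positivity)))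
    have hn' : (D.len : ℝ) ≤ n₀ := by exact_mod_cast hn
    have h1 : (1 : ℝ) ≤ (n₀ : ℝ) * n₀ + 1 := by nlinarith [mul_self_nonneg (n₀ : ℝ)]
    calc (D.len : ℝ) ^ 2 * ((D.len : ℝ) * D.len + 1) ^ (D.len * D.len)
        ≤ (n₀ : ℝ) ^ 2 * ((n₀ : ℝ) * n₀ + 1) ^ (D.len * D.len) := by gcongr
      _ ≤ _ := by gcongr

end Counting

/-! ### Graphicness by majorization. -/

section Existence

open Finset
open scoped Classical

variable {n : ℕ}

theorem exists_adj_not_adj {G : SimpleGraph (Fin n)} {i j : Fin n} (h : degs G j < degs G i) :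
    ∃ u, G.Adj i u ∧ u ≠ j ∧ ¬ G.Adj u j := by
  by_contra! hcon
  refine absurd h (not_lt.2 ?_)
  by_cases hij : G.Adj i j
  · have hsub : nbhd G i ⊆ insert j ((nbhd G j).erase i) := by
      intro u hu
      rw [mem_nbhd] at hu
      rw [mem_insert, mem_erase, mem_nbhd]
      by_cases huj : u = j
      · exact Or.inl huj
      · exact Or.inr ⟨hu.ne.symm, (hcon u hu huj).symm⟩
    refine (card_le_card hsub).trans ((card_insert_le _ _).trans ?_)
    rw [card_erase_add_one (mem_nbhd.2 hij.symm), degs]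
  · refine card_le_card fun u hu => ?_
    rw [mem_nbhd] at hu ⊢
    exact (hcon u hu fun e => hij (e ▸ hu)).symm

/-- A sequence dominated in the majorization order by the degrees of a graph is graphic. -/
theorem exists_degs_eq_of_majorized {d : Fin n → ℕ} (hd : Antitone d) (G : SimpleGraph (Fin n))
    (hsum : ∑ x, degs G x = ∑ x, d x)
    (hpre : ∀ k : ℕ, ∑ x with x.val < k, d x ≤ ∑ x with x.val < k, degs G x) :
    ∃ H : SimpleGraph (Fin n), degs H = d := by
  induction hN : ∑ x, (degs G x - d x) using Nat.strong_induction_on generalizing G with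
  | _ N ih =>
  by_cases hle : ∀ x, d x ≤ degs G x
  · refine ⟨G, funext fun x => ?_⟩
    exact ((sum_eq_sum_iff_of_le fun x _ => hle x).1 hsum.symm x (mem_univ x)).symm
  push Not at hle
  -- With `j` the first deficient vertex, prefix domination gives an earlier `i` with excess, and a
  -- hinge move shifts one degree from `i` to `j`. Only prefixes containing `i` but not `j` lose a
  -- unit, and there domination was strict.
  obtain ⟨j, hj, hmin⟩ := WellFounded.has_min (wellFounded_lt (α := Fin n))
    {x | degs G x < d x} hle
  have hj' : degs G j < d j := hj
  have hmin' : ∀ x, x < j → d x ≤ degs G x := fun x hx => not_lt.1 fun h => hmin x h hx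
  obtain ⟨i, hij, hi⟩ : ∃ i, i < j ∧ d i < degs G i := by
    by_contra! hcon
    refine absurd (hpre (j.val + 1)) (not_le.2 (sum_lt_sum (fun x hx => ?_) ⟨j, by simp, hj'⟩))
    have hx' : x.val < j.val + 1 := (mem_filter.1 hx).2
    rcases eq_or_ne x j with rfl | hne
    · exact hj'.le
    · exact hcon x (lt_of_le_of_ne (Fin.le_def.2 (by omega)) hne)
  have hdij : d j ≤ d i := hd hij.le
  obtain ⟨u, hiu, huj, hn⟩ := exists_adj_not_adj (G := G) (i := i) (j := j) (by omega)
  have hH := degs_hinge huj hiu hn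
  set H := hinge G i u j
  have hHt : ∀ t, degs H t + (Pi.single i 1 : Fin n → ℕ) t =
      degs G t + (Pi.single j 1 : Fin n → ℕ) t := fun t => congrFun hH t
  have hsingle : ∀ (z : Fin n) (k : ℕ), ∑ x with x.val < k, (Pi.single z 1 : Fin n → ℕ) x =
      if z.val < k then 1 else 0 := by
    intro z k
    simp [sum_pi_single']
  have hHi : degs H i + 1 = degs G i := by simpa [hij.ne] using hHt i
  have hHj : degs H j = degs G j + 1 := by simpa [hij.ne'] using hHt j
  have hHo : ∀ t, t ≠ i → t ≠ j → degs H t = degs G t := by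
    intro t h₁ h₂
    simpa [h₁, h₂] using hHt t
  refine ih (∑ x, (degs H x - d x)) ?_ H ?_ ?_ rfl
  · rw [← hN]
    refine sum_lt_sum (fun x _ => ?_) ⟨i, mem_univ i, by omega⟩
    by_cases h₁ : x = i
    · subst h₁; omega
    · by_cases h₂ : x = j
      · subst h₂; omega
      · rw [hHo x h₁ h₂]
  · have := congrArg (fun f : Fin n → ℕ => ∑ x, f x) hH
    simp only [Pi.add_apply, sum_add_distrib, sum_pi_single', mem_univ, if_true] at this
    omega
  · intro k
    have h₁ := congrArg (fun f : Fin n → ℕ => ∑ x with x.val < k, f x) hH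
    simp only [Pi.add_apply, sum_add_distrib, hsingle] at h₁
    have h₂ := hpre k
    have hij' : i.val < j.val := hij
    by_cases hik : i.val < k
    · by_cases hjk : j.val < k
      · rw [if_pos hik, if_pos hjk] at h₁
        omega
      · rw [if_pos hik, if_neg hjk] at h₁
        have h₃ : ∑ x with x.val < k, d x < ∑ x with x.val < k, degs G x := by
          refine sum_lt_sum (fun x hx => hmin' x ?_) ⟨i, by simpa using hik, hi⟩
          have := (mem_filter.1 hx).2
          exact Fin.lt_def.2 (by omega)
        omega
    · rw [if_neg hik, if_neg (by omega)] at h₁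
      omega

/-- The quasi-complete graphs: a clique on the first `t` vertices, the first `s` of which are joined
to the next vertex. -/
theorem exists_quasiComplete {t : ℕ} (ht : t ≤ n) : ∀ s ≤ t, (0 < s → t < n) →
    ∃ G : SimpleGraph (Fin n),
      (∀ x, degs G x = (if x.val < t then t - 1 else 0) + (if x.val < s then 1 else 0) +
        (if x.val = t then s else 0)) ∧
      ∀ x y : Fin n, s ≤ x.val → y.val = t → ¬ G.Adj x y := by
  intro s
  induction s with
  | zero =>
    intro _ _
    let G : SimpleGraph (Fin n) :=
      { Adj := fun x y => x ≠ y ∧ x.val < t ∧ y.val < t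
        symm := ⟨fun x y h => ⟨h.1.symm, h.2.2, h.2.1⟩⟩
        loopless := ⟨fun x h => h.1 rfl⟩ }
    refine ⟨G, fun x => ?_, fun x y _ hy h => absurd h.2.2 (by omega)⟩
    by_cases hx : x.val < t
    · have : nbhd G x = (univ.filter fun y : Fin n => y.val < t).erase x := by
        ext y
        simp only [mem_nbhd, mem_erase, mem_filter, mem_univ, true_and, G]
        constructor
        · exact fun h => ⟨h.1.symm, h.2.2⟩
        · exact fun h => ⟨h.1.symm, hx, h.2⟩
      rw [degs, this, card_erase_of_mem (by simpa using hx), Fin.card_filter_val_lt]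
      simp [hx, ht, hx.ne]
    · have : nbhd G x = ∅ := by
        ext y
        simp [mem_nbhd, G, hx]
      simp [degs, this, hx]
  | succ s ih =>
    intro hs hn
    have htn := hn (by omega)
    obtain ⟨G, hG, hGn⟩ := ih (by omega) fun _ => htn
    have hne : (⟨s, by omega⟩ : Fin n) ≠ ⟨t, htn⟩ := by
      simp only [ne_eq, Fin.mk.injEq]; omega
    refine ⟨addEdge G ⟨s, by omega⟩ ⟨t, htn⟩, fun x => ?_, fun x y hx hy => ?_⟩
    · rw [degs_addEdge hne (hGn _ _ le_rfl rfl)]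
      simp only [Pi.add_apply, hG, Pi.single_apply, Fin.ext_iff]
      split_ifs <;> omega
    · rw [addEdge_adj hne]
      rintro (h | ⟨h, -⟩ | ⟨-, h⟩)
      · exact hGn x y (by omega) hy h
      · rw [h] at hx
        exact absurd hx (by simp)
      · rw [h] at hy
        exact absurd hy (show s ≠ t by omega)

theorem exists_degs_eq_of_antitone {d : Fin n → ℕ} (hd : Antitone d) {c : ℕ} (hc : ∀ x, d x ≤ c)
    (hcn : c < n) (heven : Even (∑ x, d x)) (hsum : c * (c + 1) ≤ ∑ x, d x) :
    ∃ H : SimpleGraph (Fin n), degs H = d := by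
  have hle : ∑ x, d x ≤ n * (n - 1) := by
    have := sum_le_card_nsmul univ d (n - 1) fun x _ => (hc x).trans (by omega)
    simpa using this
  set t := Nat.findGreatest (fun t => t * (t - 1) ≤ ∑ x, d x) n with ht
  have htn : t ≤ n := Nat.findGreatest_le n
  -- This is the use of `c (c + 1) ≤ Σ`: each clique vertex has degree at least `t - 1 ≥ c`, so
  -- prefixes inside the clique dominate termwise; longer prefixes contain all edge ends.
  have hct : c + 1 ≤ t := Nat.le_findGreatest (by omega) (by
    rw [Nat.add_sub_cancel, mul_comm]; exact hsum)
  have htS : t * (t - 1) ≤ ∑ x, d x :=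
    Nat.findGreatest_spec (P := fun t => t * (t - 1) ≤ ∑ x, d x) (m := 0) (by omega) (by simp)
  have htlt : t < n → ∑ x, d x < (t + 1) * t := fun h => by
    have := Nat.findGreatest_is_greatest (P := fun t => t * (t - 1) ≤ ∑ x, d x)
      (show t < t + 1 by omega) (by omega)
    simpa using this
  obtain ⟨s, hs⟩ : ∃ s, ∑ x, d x = t * (t - 1) + 2 * s := by
    obtain ⟨a, ha⟩ := heven
    obtain ⟨b, hb⟩ := Nat.even_mul_pred_self t
    exact ⟨a - b, by omega⟩
  have hexp : (t + 1) * t = t * (t - 1) + 2 * t := by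
    obtain ⟨e, he⟩ := Nat.exists_eq_add_of_le' (show 1 ≤ t by omega)
    rw [he, Nat.add_sub_cancel]
    ring
  have hs0 : 0 < s → t < n := by
    intro h
    by_contra h'
    have : t = n := by omega
    rw [this] at hs
    omega
  have hst : s ≤ t := by
    rcases Nat.eq_zero_or_pos s with h | h
    · omega
    · have := htlt (hs0 h)
      omega
  obtain ⟨G, hG, -⟩ := exists_quasiComplete htn s hst hs0
  have htot : ∑ x, degs G x = ∑ x, d x := by
    have hcnt : ∀ k a : ℕ, k ≤ n → ∑ x : Fin n, (if x.val < k then a else 0) = k * a := by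
      intro k a hk
      rw [← sum_filter, sum_const, Fin.card_filter_val_lt, min_eq_right hk, smul_eq_mul]
    have hlast : ∑ x : Fin n, (if x.val = t then s else 0) = s := by
      rcases Nat.eq_zero_or_pos s with h | h
      · simp [h]
      · rw [sum_eq_single ⟨t, hs0 h⟩]
        · simp
        · intro x _ hx
          rw [if_neg fun e => hx (Fin.ext e)]
        · simp
    simp only [hG, sum_add_distrib]
    rw [hcnt t _ htn, hcnt s _ (by omega), hlast, hs]
    omega
  refine exists_degs_eq_of_majorized hd G htot fun k => ?_
  by_cases hk : k ≤ t
  · refine sum_le_sum fun x hx => (hc x).trans ?_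
    have := (mem_filter.1 hx).2
    rw [hG, if_pos (by omega)]
    omega
  · have : ∑ x with x.val < k, degs G x = ∑ x, degs G x := by
      refine sum_filter_of_ne fun x _ hx => ?_
      by_contra h
      refine hx ?_
      rw [hG, if_neg (by omega), if_neg (by omega), if_neg (by omega), add_zero, add_zero]
    rw [this, htot]
    exact sum_le_sum_of_subset (filter_subset _ _)

theorem exists_degs_eq {d : Fin n → ℕ} {c : ℕ} (hc : ∀ x, d x ≤ c) (hcn : c < n)
    (heven : Even (∑ x, d x)) (hsum : c * (c + 1) ≤ ∑ x, d x) :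
    ∃ H : SimpleGraph (Fin n), degs H = d := by
  set σ : Equiv.Perm (Fin n) := Fin.revPerm.trans (Tuple.sort d) with hσ
  have hanti : Antitone (d ∘ σ) := by
    intro x y hxy
    exact Tuple.monotone_sort d (Fin.rev_le_rev.2 hxy)
  have hs : ∑ x, (d ∘ σ) x = ∑ x, d x := Equiv.sum_comp σ d
  obtain ⟨H, hH⟩ := exists_degs_eq_of_antitone hanti (fun x => hc (σ x)) hcn
    (by rwa [hs]) (by rwa [hs])
  refine ⟨H.comap σ.symm, funext fun x => ?_⟩
  have h₁ : nbhd (H.comap σ.symm) x = (nbhd H (σ.symm x)).map σ.toEmbedding := by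
    ext y
    simp [mem_nbhd]
  have h₂ := congrFun hH (σ.symm x)
  rw [degs, h₁, card_map]
  simpa [degs] using h₂

theorem fullyGraphic_regionGSPlus {ε : ℝ} (hε : 0 < ε) : FullyGraphic (regionGSPlus ε) := by
  intro D hD
  obtain ⟨hsq, hε1⟩ := sq_le_of_mem_regionGSPlus hD
  obtain ⟨hlen, hmin, -, -⟩ := hD
  have hmul : D.len * 2 ≤ D.total := (Nat.mul_le_mul_left _ hmin).trans D.len_mul_minDeg_le
  have hmul' : (D.len : ℝ) * 2 ≤ D.total := by exact_mod_cast hmul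
  have hS : 1 ≤ ε ^ 2 * D.total := by
    rw [div_le_iff₀ (by positivity)] at hlen
    nlinarith [sq_nonneg ε]
  have key : D.maxDeg * (D.maxDeg + 1) ≤ D.total := by
    have h0 : (0 : ℝ) ≤ D.total := Nat.cast_nonneg _
    -- Since `Σ ≥ 2n ≥ 1/ε²`, one has `c₁² ≤ Σ ≤ (ε Σ)²`; then `c₁² + c₁ ≤ (1 - ε) Σ + ε Σ`.
    have h₁ : (D.maxDeg : ℝ) ≤ ε * D.total := by
      refine abs_le_of_sq_le_sq' ?_ (by positivity) |>.2
      nlinarith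
    have h₂ : (D.maxDeg : ℝ) * (D.maxDeg + 1) ≤ D.total := by nlinarith
    exact_mod_cast h₂
  have : Nonempty (Fin D.len) := ⟨⟨0, D.len_pos⟩⟩
  obtain ⟨i, hi⟩ := exists_eq_ciSup_of_finite (f := D.deg)
  have hlt : D.maxDeg < D.len := lt_of_eq_of_lt hi.symm (D.deg_lt i)
  obtain ⟨H, hH⟩ := exists_degs_eq (c := D.maxDeg) D.deg_le_maxDeg hlt D.even_sum key
  exact ⟨H, mem_realizations.2 hH⟩

end Existence

/-! ### Infinitude and comparison with the Greenhill–Sfragara region. -/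

section Examples

theorem DegreeSequence.maxDeg_eq (D : DegreeSequence) {c : ℕ} (i : Fin D.len) (hi : D.deg i = c)
    (h : ∀ x, D.deg x ≤ c) : D.maxDeg = c := by
  have : Nonempty (Fin D.len) := ⟨i⟩
  exact le_antisymm (ciSup_le h) (hi ▸ D.deg_le_maxDeg i)

theorem DegreeSequence.le_minDeg (D : DegreeSequence) {c : ℕ} (h : ∀ x, c ≤ D.deg x) :
    c ≤ D.minDeg := by
  have : Nonempty (Fin D.len) := ⟨⟨0, D.len_pos⟩⟩
  exact le_ciInf h

/-- The degree sequence `(3, …, 3)` of length `2k + 4`. -/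
def cubicSequence (k : ℕ) : DegreeSequence where
  len := 2 * k + 4
  len_pos := by omega
  deg _ := 3
  deg_pos _ := by omega
  deg_lt _ := by omega
  even_sum := ⟨3 * (k + 2), by simp; ring⟩

theorem cubicSequence_mem {ε : ℝ} {k : ℕ} (hε1 : ε < 1) (h₁ : 1 / (2 * ε ^ 2) ≤ k)
    (h₂ : 3 / (1 - ε) ≤ k) : cubicSequence k ∈ regionGSPlus ε := by
  have hmax : (cubicSequence k).maxDeg = 3 :=
    DegreeSequence.maxDeg_eq _ ⟨0, (cubicSequence k).len_pos⟩ rfl fun _ => le_rfl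
  have hmin : 3 ≤ (cubicSequence k).minDeg := DegreeSequence.le_minDeg _ fun _ => le_rfl
  have htot : (cubicSequence k).total = 6 * k + 12 := by
    change ∑ _x : Fin (2 * k + 4), 3 = _
    simp
    ring
  refine ⟨?_, by omega, by omega, ?_⟩
  · refine h₁.trans ?_
    change (k : ℝ) ≤ ((2 * k + 4 : ℕ) : ℝ)
    exact_mod_cast (by omega : k ≤ 2 * k + 4)
  · rw [hmax, htot]
    refine Real.le_sqrt_of_sq_le ?_
    rw [div_le_iff₀ (by linarith)] at h₂
    push_cast
    nlinarith

theorem infinite_regionGSPlus {ε : ℝ} (hε1 : ε < 1) : (regionGSPlus ε).Infinite := by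
  obtain ⟨k₀, hk₀⟩ := exists_nat_ge (max (1 / (2 * ε ^ 2)) (3 / (1 - ε)))
  refine Set.infinite_of_injective_forall_mem (f := fun k : ℕ => cubicSequence (k₀ + k)) ?_ ?_
  · intro a b hab
    have : 2 * (k₀ + a) + 4 = 2 * (k₀ + b) + 4 := congrArg DegreeSequence.len hab
    omega
  · intro k
    have hk : (k₀ : ℝ) ≤ ((k₀ + k : ℕ) : ℝ) := by exact_mod_cast Nat.le_add_right _ _
    exact cubicSequence_mem hε1 ((le_max_left _ _).trans (hk₀.trans hk))
      ((le_max_right _ _).trans (hk₀.trans hk))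

theorem regionGS_eq : regionGS = regionGSPlus (8 / 9) := by
  ext D
  have hlen : (1 : ℝ) ≤ D.len := by exact_mod_cast D.len_pos
  have h : (1 - 8 / 9 : ℝ) * D.total = D.total / 9 := by ring
  change (_ ∧ _ ∧ _) ↔ (_ ∧ _ ∧ _ ∧ _)
  rw [h]
  constructor
  -- For `ε = 8/9` the length condition reads `n ≥ 81/128` and is vacuous.
  · exact fun hD => ⟨by norm_num; linarith, hD⟩
  · exact fun hD => hD.2

/-- The degree sequence `(2m, 2, …, 2)` of length `18m² - m`, whose sum is `36m² - 2`. -/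
def hubSequence (m : ℕ) (hm : 2 ≤ m) : DegreeSequence where
  len := (18 * m - 1) * m
  len_pos := by
    apply Nat.mul_pos <;> omega
  deg i := if i.val = 0 then 2 * m else 2
  deg_pos i := by split_ifs <;> omega
  deg_lt i := by
    have : 35 * m ≤ (18 * m - 1) * m := Nat.mul_le_mul_right _ (by omega)
    split_ifs <;> omega
  even_sum := by
    refine Finset.even_sum _ fun i _ => ?_
    split_ifs
    · exact even_two_mul m
    · exact even_two

theorem hubSequence_total (m : ℕ) (hm : 2 ≤ m) :
    ((hubSequence m hm).total : ℝ) = 36 * m ^ 2 - 2 := by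
  have h₁ : ∀ N : ℕ, 0 < N → ∑ i : Fin N, (if i.val = 0 then 2 * m else 2) + 2 = 2 * N + 2 * m := by
    intro N hN
    obtain ⟨N, rfl⟩ := Nat.exists_eq_add_of_le' hN
    rw [Fin.sum_univ_succ]
    simp
    ring
  have h₂ : (hubSequence m hm).total + 2 = 2 * ((18 * m - 1) * m) + 2 * m :=
    h₁ _ (hubSequence m hm).len_pos
  have h₃ : 18 * m - 1 + 1 = 18 * m := by omega
  have h₄ : (hubSequence m hm).total + 2 = 36 * m ^ 2 := by
    calc _ = 2 * ((18 * m - 1 + 1) * m) := by rw [h₂]; ring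
      _ = _ := by rw [h₃]; ring
  have h₅ : ((hubSequence m hm).total : ℝ) + 2 = 36 * m ^ 2 := by exact_mod_cast h₄
  linarith

theorem hubSequence_maxDeg (m : ℕ) (hm : 2 ≤ m) : (hubSequence m hm).maxDeg = 2 * m := by
  refine DegreeSequence.maxDeg_eq _ ⟨0, (hubSequence m hm).len_pos⟩ rfl fun x => ?_
  change (if x.val = 0 then 2 * m else 2) ≤ _
  split_ifs <;> omega

/-- The length is tuned so that `c₁² = 4m²` just exceeds `Σ / 9 = 4m² - 2/9`; any factor `1 - ε >
1/9` readmits the sequence for large `m`. -/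
theorem hubSequence_notMem (m : ℕ) (hm : 2 ≤ m) : hubSequence m hm ∉ regionGS := by
  rintro ⟨-, -, h⟩
  have hm' : (2 : ℝ) ≤ m := by exact_mod_cast hm
  rw [hubSequence_maxDeg, hubSequence_total, Real.le_sqrt (by positivity) (by nlinarith)] at h
  push_cast at h
  nlinarith

theorem hubSequence_mem {ε : ℝ} {m : ℕ} (hm : 2 ≤ m) (hε : ε < 8 / 9)
    (h₁ : 1 / (2 * ε ^ 2) ≤ m) (h₂ : 1 / (8 - 9 * ε) ≤ m) :
    hubSequence m hm ∈ regionGSPlus ε := by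
  have hm' : (2 : ℝ) ≤ m := by exact_mod_cast hm
  refine ⟨?_, ?_, ?_, ?_⟩
  · refine h₁.trans ?_
    have : m ≤ (18 * m - 1) * m := Nat.le_mul_of_pos_left _ (by omega)
    change (m : ℝ) ≤ (((18 * m - 1) * m : ℕ) : ℝ)
    exact_mod_cast this
  · refine DegreeSequence.le_minDeg _ fun x => ?_
    change _ ≤ if x.val = 0 then 2 * m else 2
    split_ifs <;> omega
  · rw [hubSequence_maxDeg]; omega
  · rw [hubSequence_maxDeg, hubSequence_total]
    refine Real.le_sqrt_of_sq_le ?_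
    rw [div_le_iff₀ (by linarith)] at h₂
    push_cast
    nlinarith

theorem ssubset_regionGSPlus {ε : ℝ} (hε : ε < 8 / 9) :
    {D ∈ regionGS | 1 / (2 * ε ^ 2) ≤ (D.len : ℝ)} ⊂ regionGSPlus ε := by
  refine (Set.ssubset_iff_of_subset ?_).2 ?_
  · rintro D ⟨⟨h₁, h₂, h₃⟩, h₄⟩
    refine ⟨h₄, h₁, h₂, h₃.trans (Real.sqrt_le_sqrt ?_)⟩
    have : (0 : ℝ) ≤ D.total := Nat.cast_nonneg _
    nlinarith
  · obtain ⟨k, hk⟩ := exists_nat_ge (max (1 / (2 * ε ^ 2)) (1 / (8 - 9 * ε)))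
    have hk' : (k : ℝ) ≤ ((k + 2 : ℕ) : ℝ) := by exact_mod_cast Nat.le_add_right _ _
    refine ⟨hubSequence (k + 2) (by omega), hubSequence_mem _ hε
      ((le_max_left _ _).trans (hk.trans hk')) ((le_max_right _ _).trans (hk.trans hk')), ?_⟩
    exact fun h => hubSequence_notMem _ _ h.1

end Examples

theorem theorem2p22 :
    (∀ ε : ℝ, 0 < ε → FullyGraphic (regionGSPlus ε) ∧ PStable (regionGSPlus ε)) ∧
    (∀ ε : ℝ, 0 < ε → ε < 1 → (regionGSPlus ε).Infinite) ∧
    regionGS = regionGSPlus (8 / 9) ∧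
    (∀ ε : ℝ, 0 < ε → ε < 8 / 9 →
      {D ∈ regionGS | 1 / (2 * ε ^ 2) ≤ (D.len : ℝ)} ⊂ regionGSPlus ε) :=
  ⟨fun _ hε => ⟨fullyGraphic_regionGSPlus hε, pStable_regionGSPlus hε⟩,
    fun _ _ hε1 => infinite_regionGSPlus hε1, regionGS_eq,
    fun _ _ hε => ssubset_regionGSPlus hε⟩
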